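/- **Theorem 3.5 (Approximation B).** Let $\gamma>0$ and let $F$ be a distribution on $[0,\infty)$ with finite mean $\mu_F>0$ such that $\rho:=\gamma\mu_F<1$. Let $\Pi$ be a discrete distribution with mass $\pi_i\ge 0$ at $s_i$, $i\in\{1,2,\dots\}$, where $0<s_1<s_2<\cdots$ and $\sum_i\pi_i=1$, with finite mean $\mu_\Pi=\sum_i\pi_i s_i$. Let $\xi\ge 1$ be an integer and let $G_m$ be the Erlang distribution with shape $\xi$ and rate $\xi$. Let $\Pi\star G_m$ be the distribution of the product of two independent random variables with distributions $\Pi$ and $G_m$, and consider the Cramér–Lundberg risk process $$R_t=u+t-\sum_{k=1}^{N_t}X_k,\qquad t\ge 0,$$ with initial reserve $u\ge 0$, where $X_1,X_2,\dots$ are i.i.d. with distribution $\Pi\star G_m$ and, independently, $(N_t)$ is a Poisson process with intensity $\gamma\mu_F/\mu_\Pi$. Write $dH_\Pi(s)=s\,d\Pi(s)/\mu_\Pi$ for the moment distribution of $\Pi$, $\widehat G_m(x)=\int_0^x(1-G_m(t))\,dt$ $(x\ge 0)$ for the integrated tail of $G_m$ (which has mean $1$), and, for a distribution $H$ on $[0,\infty)$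 with $n$-fold convolutions $H^{*n}$, $$\psi_H(u)=(1-\rho)\sum_{n=1}^\infty\rho^n\bigl(1-H^{*n}(u)\bigr).$$ Then for every $u\ge0$ the ruin probability of this process is $\psi_{H_\Pi\star\widehat G_m}(u)$, and it has the convergent series expansion $$\mathbb P(R_t<0\text{ for some }t>0)=\psi_{H_\Pi\star\widehat G_m}(u)=\sum_{n=0}^\infty\kappa_n\frac{(\xi u/s_1)^n e^{-\xi u/s_1}}{n!},$$ where $$\kappa_n=\begin{cases}\gamma\mu_F,&n=0,\\[1mm](\gamma\mu_F-1)\Bigl(1+\dfrac{\gamma\mu_F s_1}{\mu_\Pi\xi}\Bigr)^n+1,&1\le n\le\xi,\\[2mm]\dfrac{\gamma\mu_F s_1}{\mu_\Pi\xi}\displaystyle\sum_{i=0}^{n-1}\kappa_{n-1-i}\,\mathcal C_i+\dfrac{\gamma\mu_F}{\mu_\Pi}\,\mathcal D_n,&n>\xi,\end{cases}$$ $$\mathcal C_i=\sum_{j=1}^\infty\pi_j\,\mathrm{Bin}(\xi-1;i,s_1/s_j),\qquad \mathcal D_n=\sum_{j=1}^\infty\pi_j s_j\sum_{k=0}^{\xi-1}\frac{\xi-k}{\xi}\,\mathrm{bin}(k;n,s_1/s_j),$$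 and $\mathrm{bin}(\cdot;n,q)$ and $\mathrm{Bin}(\cdot;n,q)$ denote the probability mass function and the cumulative distribution function of the binomial distribution with parameters $n$ and $q$. -/

import Mathlib

open MeasureTheory ProbabilityTheory
open scoped MeasureTheory

noncomputable section

namespace Ruin

/-! ### The Cramér–Lundberg risk process -/

/-- `T` are the interarrival times of a Poisson process of intensity `lam`, and `X` are the claim
sizes, i.i.d. with distribution `B` and independent of the Poisson process. All the random
variables `T 0, T 1, …, X 0, X 1, …` are mutually independent. -/
structure IsCramerLundberg {Ω : Type*} [MeasurableSpace Ω] (P : Measure Ω)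
    (lam : ℝ) (B : Measure ℝ) (T X : ℕ → Ω → ℝ) : Prop where
  measurable_interarrival : ∀ k, Measurable (T k)
  measurable_claim : ∀ k, Measurable (X k)
  map_interarrival : ∀ k, P.map (T k) = expMeasure lam
  map_claim : ∀ k, P.map (X k) = B
  indep : iIndepFun (Sum.elim T X : ℕ ⊕ ℕ → Ω → ℝ) P

/-- The time of the `(n+1)`-st claim. -/
def arrivalTime {Ω : Type*} (T : ℕ → Ω → ℝ) (n : ℕ) (ω : Ω) : ℝ :=
  ∑ k ∈ Finset.range (n + 1), T k ω

/-- The number `N_t` of claims up to time `t`. -/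
def claimCount {Ω : Type*} (T : ℕ → Ω → ℝ) (t : ℝ) (ω : Ω) : ℕ :=
  {n : ℕ | arrivalTime T n ω ≤ t}.ncard

/-- The reserve `R_t = u + t - ∑_{k ≤ N_t} X_k`, with unit premium rate. -/
def reserve {Ω : Type*} (T X : ℕ → Ω → ℝ) (u t : ℝ) (ω : Ω) : ℝ :=
  u + t - ∑ k ∈ Finset.range (claimCount T t ω), X k ω

/-- The probability that the reserve ever drops below zero. -/
def ruinProbability {Ω : Type*} [MeasurableSpace Ω] (P : Measure Ω) (T X : ℕ → Ω → ℝ)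
    (u : ℝ) : ℝ :=
  P.real {ω | ∃ t : ℝ, 0 < t ∧ reserve T X u t ω < 0}

/-! ### Distributions -/

/-- The mean of a distribution on the real line. -/
def mean (F : Measure ℝ) : ℝ := ∫ x, x ∂F

/-- The discrete distribution with mass `p j` at the point `s j`. -/
def discreteDist (p s : ℕ → ℝ) : Measure ℝ :=
  Measure.sum fun j => ENNReal.ofReal (p j) • Measure.dirac (s j)

/-- The Erlang distribution with shape `ξ` and rate `ξ`. -/
def erlang (ξ : ℕ) : Measure ℝ := gammaMeasure (ξ : ℝ) (ξ : ℝ)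

/-- The Mellin–Stieltjes convolution: the distribution of the product of two independent random
variables with distributions `F` and `G`. -/
def mellinConv (F G : Measure ℝ) : Measure ℝ := Measure.mconv F G

/-- The moment distribution `dH_F(s) = s dF(s) / μ_F`. -/
def momentDist (F : Measure ℝ) : Measure ℝ :=
  F.withDensity fun x => ENNReal.ofReal (x / mean F)

/-- The integrated tail distribution, with density `t ↦ (1 - F(t)) / μ_F` on `[0, ∞)`. -/
def integratedTail (F : Measure ℝ) : Measure ℝ :=
  (volume.restrict (Set.Ici 0)).withDensity fun t =>
    ENNReal.ofReal (F.real (Set.Ioi t) / mean F)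

/-- The `n`-fold (additive) convolution power of a distribution. -/
def convPower (H : Measure ℝ) : ℕ → Measure ℝ
  | 0 => Measure.dirac 0
  | n + 1 => Measure.conv H (convPower H n)

/-- The Pollaczek–Khinchine functional
`ψ_H(u) = (1 - ρ) ∑_{n ≥ 1} ρ ^ n (1 - H^{*n}(u))`. -/
def psi (ρ : ℝ) (H : Measure ℝ) (u : ℝ) : ℝ :=
  (1 - ρ) * ∑' n : ℕ, ρ ^ (n + 1) * (convPower H (n + 1)).real (Set.Ioi u)

/-! ### The coefficients

The support points are `s 0 < s 1 < …`, with weights `p 0, p 1, …`; so `s 0` is the smallest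
support point, denoted `s_1` when the points are numbered from one. -/

/-- Binomial probability mass function with parameters `n` and `q`. -/
def binPmf (k n : ℕ) (q : ℝ) : ℝ := (n.choose k : ℝ) * q ^ k * (1 - q) ^ (n - k)

/-- Binomial distribution function with parameters `n` and `q`, at the integer `k`. -/
def binCdf (k n : ℕ) (q : ℝ) : ℝ := ∑ l ∈ Finset.range (k + 1), binPmf l n q

/-- `𝒞_i = ∑_j π_j Bin(ξ - 1; i, s_1 / s_j)`. -/
def coefC (p s : ℕ → ℝ) (ξ i : ℕ) : ℝ :=
  ∑' j, p j * binCdf (ξ - 1) i (s 0 / s j)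

/-- `𝒟_n = ∑_j π_j s_j ∑_{k < ξ} (ξ - k) / ξ * bin(k; n, s_1 / s_j)`. -/
def coefD (p s : ℕ → ℝ) (ξ n : ℕ) : ℝ :=
  ∑' j, p j * s j *
    ∑ k ∈ Finset.range ξ, ((ξ : ℝ) - (k : ℝ)) / (ξ : ℝ) * binPmf k n (s 0 / s j)

/-- The coefficients `κ_n`, where `ρ` is the average claim amount per unit time and `m` is the mean
of the scaling distribution. -/
def kappa (ρ m : ℝ) (p s : ℕ → ℝ) (ξ : ℕ) (n : ℕ) : ℝ :=
  if n = 0 then ρ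
  else if n ≤ ξ then (ρ - 1) * (1 + ρ * s 0 / (m * ξ)) ^ n + 1
  else ρ * s 0 / (m * ξ) * (∑ i : Fin n, kappa ρ m p s ξ (n - 1 - i) * coefC p s ξ i)
    + ρ / m * coefD p s ξ n
termination_by n
decreasing_by omega

theorem kappa_zero (ρ m : ℝ) (p s : ℕ → ℝ) (ξ : ℕ) : kappa ρ m p s ξ 0 = ρ := by
  rw [kappa]; simp

theorem kappa_of_le (ρ m : ℝ) (p s : ℕ → ℝ) (ξ n : ℕ) (h1 : 1 ≤ n) (h2 : n ≤ ξ) :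
    kappa ρ m p s ξ n = (ρ - 1) * (1 + ρ * s 0 / (m * ξ)) ^ n + 1 := by
  rw [kappa, if_neg (by omega), if_pos h2]

theorem kappa_of_lt (ρ m : ℝ) (p s : ℕ → ℝ) (ξ n : ℕ) (h : ξ < n) :
    kappa ρ m p s ξ n =
      ρ * s 0 / (m * ξ) * (∑ i ∈ Finset.range n, kappa ρ m p s ξ (n - 1 - i) * coefC p s ξ i)
        + ρ / m * coefD p s ξ n := by
  rw [kappa, if_neg (by omega), if_neg (by omega),
    Finset.sum_range fun i => kappa ρ m p s ξ (n - 1 - i) * coefC p s ξ i]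

theorem binPmf_nonneg (k n : ℕ) {q : ℝ} (h0 : 0 ≤ q) (h1 : q ≤ 1) : 0 ≤ binPmf k n q := by
  have : 0 ≤ 1 - q := by linarith
  unfold binPmf; positivity

theorem sum_binPmf_le_one (m n : ℕ) {q : ℝ} (h0 : 0 ≤ q) (h1 : q ≤ 1) :
    ∑ k ∈ Finset.range m, binPmf k n q ≤ 1 := by
  have hfull : ∑ k ∈ Finset.range (n + 1), binPmf k n q = 1 := by
    have h := add_pow q (1 - q) n
    rw [add_sub_cancel, one_pow] at h
    rw [h]
    exact Finset.sum_congr rfl fun k _ => by unfold binPmf; ring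
  have hmax : ∑ k ∈ Finset.range (max m (n + 1)), binPmf k n q = 1 := by
    rw [← hfull]
    symm
    apply Finset.sum_subset (Finset.range_mono (le_max_right _ _))
    intro k _ hk
    have : n < k := by simpa using hk
    simp [binPmf, Nat.choose_eq_zero_of_lt this]
  rw [← hmax]
  exact Finset.sum_le_sum_of_subset_of_nonneg (Finset.range_mono (le_max_left _ _))
    fun k _ _ => binPmf_nonneg k n h0 h1

/-- The series defining `coefC` converges. -/
theorem summable_coefC {p s : ℕ → ℝ} (hp : ∀ j, 0 ≤ p j) (hp1 : Summable p) (hs0 : 0 < s 0)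
    (hs : StrictMono s) (ξ i : ℕ) :
    Summable fun j => p j * binCdf (ξ - 1) i (s 0 / s j) := by
  have hpos : ∀ j, 0 < s j := fun j => hs0.trans_le (hs.monotone (Nat.zero_le j))
  have h0 : ∀ j, 0 ≤ s 0 / s j := fun j => div_nonneg hs0.le (hpos j).le
  have h1 : ∀ j, s 0 / s j ≤ 1 := fun j =>
    (div_le_one (hpos j)).2 (hs.monotone (Nat.zero_le j))
  refine Summable.of_nonneg_of_le (fun j => mul_nonneg (hp j)
    (Finset.sum_nonneg fun k _ => binPmf_nonneg k i (h0 j) (h1 j))) (fun j => ?_) hp1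
  exact mul_le_of_le_one_right (hp j) (sum_binPmf_le_one _ _ (h0 j) (h1 j))

/-- The series defining `coefD` converges. -/
theorem summable_coefD {p s : ℕ → ℝ} (hp : ∀ j, 0 ≤ p j) (hps : Summable fun j => p j * s j)
    (hs0 : 0 < s 0) (hs : StrictMono s) (ξ n : ℕ) :
    Summable fun j => p j * s j *
      ∑ k ∈ Finset.range ξ, ((ξ : ℝ) - (k : ℝ)) / (ξ : ℝ) * binPmf k n (s 0 / s j) := by
  have hpos : ∀ j, 0 < s j := fun j => hs0.trans_le (hs.monotone (Nat.zero_le j))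
  have h0 : ∀ j, 0 ≤ s 0 / s j := fun j => div_nonneg hs0.le (hpos j).le
  have h1 : ∀ j, s 0 / s j ≤ 1 := fun j =>
    (div_le_one (hpos j)).2 (hs.monotone (Nat.zero_le j))
  have hw : ∀ k ∈ Finset.range ξ, 0 ≤ ((ξ : ℝ) - (k : ℝ)) / (ξ : ℝ) ∧
      ((ξ : ℝ) - (k : ℝ)) / (ξ : ℝ) ≤ 1 := by
    intro k hk
    have hk' : (k : ℝ) < ξ := by exact_mod_cast Finset.mem_range.1 hk
    have hk0 : (0 : ℝ) ≤ k := Nat.cast_nonneg k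
    constructor
    · exact div_nonneg (by linarith) (by linarith)
    · exact (div_le_one (by linarith)).2 (by linarith)
  refine Summable.of_nonneg_of_le (fun j => mul_nonneg (mul_nonneg (hp j) (hpos j).le)
    (Finset.sum_nonneg fun k hk => mul_nonneg (hw k hk).1 (binPmf_nonneg k n (h0 j) (h1 j))))
    (fun j => ?_) hps
  refine mul_le_of_le_one_right (mul_nonneg (hp j) (hpos j).le)
    (le_trans (Finset.sum_le_sum fun k hk => ?_) (sum_binPmf_le_one ξ n (h0 j) (h1 j)))
  exact mul_le_of_le_one_left (binPmf_nonneg k n (h0 j) (h1 j)) (hw k hk).2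

end Ruin

end

/-!
The starting point is the geometric compound `M = ∑ (1 - ρ) ρ ^ n • H ^ {*n}`. On `u ≥ 0` the
Pollaczek–Khinchine functional `psi` is the tail `M (Ioi u)`, so everything is expressed through the
survival function `φ u = M (Iic u)`, which vanishes on the negative half-line.
The moment distribution of `Π` scaled by the integrated tail of the Erlang distribution is the
integrated tail of `B = Π ⋆ G` (`mellinConv_momentDist_integratedTail`), so that for `u ≥ 0`
`φ u = 1 - ρ + λ ∫ φ (u - x) B (x, ∞) dx`, the renewal equation (`survival_renewal`).

*Ruin probability.* Integrating the renewal equation against an exponential time gives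
`φ u = E φ (u + T - X)` for `u ≥ 0` (`harmonic_of_renewal`); in extended nonnegative reals only
Tonelli's theorem is needed. Ruin can occur only at claim times (`exists_reserve_neg_iff`). Let
`V n` be the reserve after `n` claims, stopped at ruin; then `E φ (V n) = φ u` for all `n`
(`lintegral_stoppedReserve`). By the strong law of large numbers and `ρ < 1` the reserve drifts to
infinity, so `φ (V n)` tends to one on survival, and it is eventually zero on ruin. Hence `φ u` is
the probability of survival (`ruinProbability_eq_psi`). This part holds for every claim size
distribution on `[0, ∞)` with positive finite mean.

*Series.* With `a = ξ / s 0`, Poisson thinning writes each Erlang tail, and hence `B (x, ∞)`, as a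
series in the Poisson weights of parameter `a * x`, with coefficients `𝒞_i`
(`mellinConv_erlang_Ioi`).
The convolution of the weights of indices `n` and `i` is, up to the factor `1 / a`, the weight of
index `n + i + 1`. The renewal equation for `φ` therefore becomes the recursion
`σ_{n+1} = 1 - ρ + (λ / a) ∑_{k + i = n} σ_k 𝒞_i`. The identity
`𝒟_n - 𝒟_{n+1} = (s 0 / ξ) 𝒞_n` and the fact that `𝒞_i = 1` for `i < ξ` show that
`σ_n = 1 - κ_n` satisfies it in all three cases (`one_sub_kappa_succ`). These numbers are
nonnegative and grow at most geometrically, so the series is locally bounded, and bounded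
solutions of the renewal equation are unique (`renewal_le`). Subtracting from
the sum `1` of all Poisson weights gives the series with coefficients `κ_n`.
-/

namespace Ruin

open Set Filter Topology
open scoped ENNReal
open Finset.HasAntidiagonal (antidiagonal mem_antidiagonal)

/-! ### Integrated tails and moment distributions -/

theorem ae_nonneg_of_measure_Iio {F : Measure ℝ} (hF : F (Iio 0) = 0) : ∀ᵐ x ∂F, 0 ≤ x := by
  rw [ae_iff]
  simpa [Iio_def] using hF

theorem lintegral_ofReal_eq_mean {F : Measure ℝ} (hF : F (Iio 0) = 0)
    (hint : Integrable (fun x : ℝ => x) F) :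
    ∫⁻ x, ENNReal.ofReal x ∂F = ENNReal.ofReal (mean F) :=
  (ofReal_integral_eq_lintegral_ofReal hint (ae_nonneg_of_measure_Iio hF)).symm

/-- The mean of a distribution on `[0, ∞)` is the total mass of its tail. -/
theorem lintegral_tail_eq_mean {F : Measure ℝ} (hF : F (Iio 0) = 0)
    (hint : Integrable (fun x : ℝ => x) F) :
    ∫⁻ t in Ioi 0, F (Ioi t) = ENNReal.ofReal (mean F) := by
  rw [← lintegral_ofReal_eq_mean hF hint,
    lintegral_eq_lintegral_meas_lt F (f := fun x => x) (ae_nonneg_of_measure_Iio hF)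
      measurable_id.aemeasurable]
  rfl

theorem measurable_tail (F : Measure ℝ) : Measurable fun t => F (Ioi t) :=
  Antitone.measurable fun _ _ h => measure_mono (Ioi_subset_Ioi h)

theorem measurable_measure_Iic (F : Measure ℝ) : Measurable fun t => F (Iic t) :=
  Monotone.measurable fun _ _ h => measure_mono (Iic_subset_Iic.2 h)

/-- Integration against the integrated tail distribution; the endpoint `0` is a null set. -/
theorem lintegral_integratedTail (F : Measure ℝ) [IsFiniteMeasure F] (hm : 0 < mean F)
    {f : ℝ → ℝ≥0∞} (hf : Measurable f) :
    ∫⁻ x, f x ∂(integratedTail F) =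
      (ENNReal.ofReal (mean F))⁻¹ * ∫⁻ x in Ioi 0, f x * F (Ioi x) := by
  have hdens : (fun t => ENNReal.ofReal (F.real (Ioi t) / mean F)) =
      fun t => (ENNReal.ofReal (mean F))⁻¹ * F (Ioi t) := by
    funext t
    rw [ENNReal.ofReal_div_of_pos hm, measureReal_def,
      ENNReal.ofReal_toReal (measure_ne_top F _), ENNReal.div_eq_inv_mul]
  have hmeas : Measurable fun t => (ENNReal.ofReal (mean F))⁻¹ * F (Ioi t) :=
    (measurable_tail F).const_mul _
  rw [integratedTail, hdens, lintegral_withDensity_eq_lintegral_mul _ hmeas hf,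
    ← setLIntegral_congr Ioi_ae_eq_Ici,
    ← lintegral_const_mul _ (by exact hf.mul (measurable_tail F))]
  refine lintegral_congr fun x => ?_
  simp only [Pi.mul_apply]
  ring

theorem lintegral_momentDist (F : Measure ℝ) (hm : 0 < mean F)
    {f : ℝ → ℝ≥0∞} (hf : Measurable f) :
    ∫⁻ x, f x ∂(momentDist F) =
      (ENNReal.ofReal (mean F))⁻¹ * ∫⁻ x, ENNReal.ofReal x * f x ∂F := by
  rw [momentDist, lintegral_withDensity_eq_lintegral_mul _ (by fun_prop) hf,
    ← lintegral_const_mul _ (by fun_prop)]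
  refine lintegral_congr fun x => ?_
  simp only [Pi.mul_apply]
  rw [ENNReal.ofReal_div_of_pos hm, ENNReal.div_eq_inv_mul, mul_assoc]

theorem isProbabilityMeasure_integratedTail {F : Measure ℝ} [IsFiniteMeasure F]
    (hF : F (Iio 0) = 0) (hint : Integrable (fun x : ℝ => x) F) (hm : 0 < mean F) :
    IsProbabilityMeasure (integratedTail F) := by
  constructor
  have h := lintegral_integratedTail F hm (f := fun _ => 1) measurable_const
  simp only [lintegral_one, one_mul, lintegral_tail_eq_mean hF hint] at h
  rw [h, ENNReal.inv_mul_cancel (by simpa using hm) ENNReal.ofReal_ne_top]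

theorem integratedTail_Iio_zero (F : Measure ℝ) : integratedTail F (Iio 0) = 0 := by
  rw [integratedTail]
  refine withDensity_absolutelyContinuous _ _ ?_
  rw [Measure.restrict_apply measurableSet_Iio]
  simp [Iio_inter_Ici]

theorem lintegral_Ioi_comp_mul_left {c : ℝ} (hc : 0 < c) {f : ℝ → ℝ≥0∞} (hf : Measurable f) :
    ENNReal.ofReal c * ∫⁻ t in Ioi 0, f (c * t) = ∫⁻ x in Ioi 0, f x := by
  have hvol := Real.smul_map_volume_mul_left hc.ne'
  rw [abs_of_pos hc] at hvol
  have hg : Measurable ((Ioi (0 : ℝ)).indicator f) := hf.indicator measurableSet_Ioi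
  rw [← lintegral_indicator measurableSet_Ioi f]
  conv_rhs => rw [← hvol]
  rw [lintegral_smul_measure, lintegral_map hg (measurable_const_mul c),
    ← lintegral_indicator measurableSet_Ioi, smul_eq_mul]
  congr 1
  refine lintegral_congr fun t => ?_
  by_cases ht : 0 < t
  · rw [indicator_of_mem (by exact ht), indicator_of_mem (by exact mul_pos hc ht)]
  · rw [indicator_of_notMem (by exact ht),
      indicator_of_notMem (by simpa [hc] using ht)]

/-- The tail of the product of two independent random variables, the first one positive. -/
theorem mellinConv_Ioi {F G : Measure ℝ} [SFinite G] (hF : ∀ᵐ s ∂F, 0 < s) (x : ℝ) :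
    mellinConv F G (Ioi x) = ∫⁻ s, G (Ioi (x / s)) ∂F := by
  rw [mellinConv, ← lintegral_indicator_one measurableSet_Ioi,
    Measure.lintegral_mconv (measurable_one.indicator measurableSet_Ioi)]
  refine lintegral_congr_ae ?_
  filter_upwards [hF] with s hs
  rw [← lintegral_indicator_one measurableSet_Ioi]
  refine lintegral_congr fun t => ?_
  simp only [indicator, mem_Ioi, div_lt_iff₀' hs, Pi.one_apply]

theorem mellinConv_Iio_zero {F G : Measure ℝ} [SFinite G] (hF : ∀ᵐ s ∂F, 0 < s)
    (hG : G (Iio 0) = 0) : mellinConv F G (Iio 0) = 0 := by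
  rw [mellinConv, ← lintegral_indicator_one measurableSet_Iio,
    Measure.lintegral_mconv (measurable_one.indicator measurableSet_Iio)]
  rw [← lintegral_zero (μ := F)]
  refine lintegral_congr_ae ?_
  filter_upwards [hF] with s hs
  rw [← hG, ← lintegral_indicator_one measurableSet_Iio]
  refine lintegral_congr fun t => ?_
  simp only [indicator, mem_Iio, ← neg_pos, ← mul_neg, mul_pos_iff_of_pos_left hs, Pi.one_apply]

theorem integrable_mellinConv {F G : Measure ℝ} [SFinite F] [SFinite G]
    (hFint : Integrable (fun x : ℝ => x) F) (hGint : Integrable (fun x : ℝ => x) G) :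
    Integrable (fun x : ℝ => x) (mellinConv F G) := by
  rw [mellinConv, Measure.mconv,
    integrable_map_measure (f := fun x : ℝ × ℝ => x.1 * x.2) (g := fun x : ℝ => x)
      measurable_id.aestronglyMeasurable (by fun_prop)]
  exact hFint.mul_prod hGint

theorem mean_mellinConv (F G : Measure ℝ) [SFinite F] [SFinite G] :
    mean (mellinConv F G) = mean F * mean G := by
  rw [mean, mellinConv, Measure.mconv,
    integral_map (f := fun x : ℝ => x) (by fun_prop) measurable_id.aestronglyMeasurable]
  exact integral_prod_mul (fun x : ℝ => x) (fun x : ℝ => x)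

/-- Size biasing and integrated tails match: scaling the integrated tail of `G` by the moment
distribution of `F` gives the integrated tail of the scale mixture of `G` by `F`. -/
theorem mellinConv_momentDist_integratedTail {F G : Measure ℝ} [IsProbabilityMeasure F]
    [IsProbabilityMeasure G] (hF : ∀ᵐ s ∂F, 0 < s) (hFm : 0 < mean F) (hGm : 0 < mean G) :
    mellinConv (momentDist F) (integratedTail G) = integratedTail (mellinConv F G) := by
  have : IsProbabilityMeasure (mellinConv F G) := by unfold mellinConv; infer_instance
  have : SFinite (integratedTail G) := by unfold integratedTail; infer_instance
  refine Measure.ext_of_lintegral _ fun f hf => ?_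
  have hinner : ∀ s : ℝ, ∫⁻ t, f (s * t) ∂(integratedTail G) =
      (ENNReal.ofReal (mean G))⁻¹ * ∫⁻ t in Ioi 0, f (s * t) * G (Ioi t) := fun s =>
    lintegral_integratedTail G hGm (hf.comp (measurable_const_mul s))
  have hmeas : Measurable fun s => ∫⁻ t, f (s * t) ∂(integratedTail G) :=
    Measurable.lintegral_prod_right' (f := fun z : ℝ × ℝ => f (z.1 * z.2)) (by fun_prop)
  have htail : Measurable fun z : ℝ × ℝ => f z.2 * G (Ioi (z.2 / z.1)) :=
    (hf.comp measurable_snd).mul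
      ((measurable_tail G).comp (measurable_snd.div measurable_fst))
  have hleft : ∫⁻ x, f x ∂(mellinConv (momentDist F) (integratedTail G)) =
      ∫⁻ s, ∫⁻ t, f (s * t) ∂(integratedTail G) ∂(momentDist F) :=
    Measure.lintegral_mconv hf
  rw [lintegral_integratedTail _ (by rw [mean_mellinConv]; exact mul_pos hFm hGm) hf,
    hleft, lintegral_momentDist F hFm hmeas]
  have hscale : ∫⁻ s, ENNReal.ofReal s * ∫⁻ t, f (s * t) ∂(integratedTail G) ∂F =
      (ENNReal.ofReal (mean G))⁻¹ *
        ∫⁻ s, ∫⁻ x in Ioi 0, f x * G (Ioi (x / s)) ∂volume ∂F := by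
    rw [← lintegral_const_mul _ (Measurable.lintegral_prod_right' htail)]
    refine lintegral_congr_ae ?_
    filter_upwards [hF] with s hs
    rw [hinner s, ← lintegral_Ioi_comp_mul_left hs (f := fun x => f x * G (Ioi (x / s)))
      (htail.comp measurable_prodMk_left)]
    simp only [mul_div_cancel_left₀ _ hs.ne']
    ring
  rw [hscale, mean_mellinConv, ENNReal.ofReal_mul hFm.le,
    ENNReal.mul_inv (Or.inl (by simpa using hFm)) (Or.inl ENNReal.ofReal_ne_top), mul_assoc,
    lintegral_lintegral_swap htail.aemeasurable]
  congr 2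
  refine lintegral_congr fun x => ?_
  rw [mellinConv_Ioi hF, lintegral_const_mul _
    (by exact (measurable_tail G).comp (measurable_const.div measurable_id))]

/-! ### Geometric compounds -/

/-- The law of a sum of `N` independent variables with distribution `H`, where
`N` is geometric with `P (N = n) = (1 - ρ) ρ ^ n`. -/
noncomputable def compoundGeometric (ρ : ℝ) (H : Measure ℝ) : Measure ℝ :=
  Measure.sum fun n : ℕ => ENNReal.ofReal ((1 - ρ) * ρ ^ n) • convPower H n

instance isProbabilityMeasure_convPower (H : Measure ℝ) [IsProbabilityMeasure H] (n : ℕ) :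
    IsProbabilityMeasure (convPower H n) := by
  induction n with
  | zero => unfold convPower; infer_instance
  | succ n ih => unfold convPower; infer_instance

theorem hasSum_geometric_weights {ρ : ℝ} (h0 : 0 ≤ ρ) (h1 : ρ < 1) :
    HasSum (fun n : ℕ => (1 - ρ) * ρ ^ n) 1 := by
  have h := (hasSum_geometric_of_lt_one h0 h1).mul_left (1 - ρ)
  rwa [mul_inv_cancel₀ (by linarith)] at h

theorem isProbabilityMeasure_compoundGeometric {ρ : ℝ} (h0 : 0 ≤ ρ) (h1 : ρ < 1)
    (H : Measure ℝ) [IsProbabilityMeasure H] :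
    IsProbabilityMeasure (compoundGeometric ρ H) := by
  constructor
  have hnn : ∀ n : ℕ, 0 ≤ (1 - ρ) * ρ ^ n := fun n =>
    mul_nonneg (by linarith) (pow_nonneg h0 n)
  have hs := hasSum_geometric_weights h0 h1
  rw [compoundGeometric, Measure.sum_apply _ MeasurableSet.univ]
  simp only [Measure.smul_apply, measure_univ, smul_eq_mul, mul_one]
  rw [← ENNReal.ofReal_tsum_of_nonneg hnn hs.summable, hs.tsum_eq, ENNReal.ofReal_one]

theorem compoundGeometric_eq_add {ρ : ℝ} (h0 : 0 ≤ ρ) (H : Measure ℝ)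
    [IsProbabilityMeasure H] {f : ℝ → ℝ≥0∞} (hf : Measurable f) :
    ∫⁻ x, f x ∂(compoundGeometric ρ H) =
      ENNReal.ofReal (1 - ρ) * f 0 +
        ENNReal.ofReal ρ * ∫⁻ x, ∫⁻ y, f (x + y) ∂(compoundGeometric ρ H) ∂H := by
  have hf' : ∀ n, Measurable fun x => ∫⁻ y, f (x + y) ∂(convPower H n) := fun n =>
    Measurable.lintegral_prod_right' (f := fun z : ℝ × ℝ => f (z.1 + z.2)) (by fun_prop)
  simp only [compoundGeometric, lintegral_sum_measure, lintegral_smul_measure, smul_eq_mul]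
  rw [tsum_eq_zero_add' ENNReal.summable]
  congr 1
  · simp [convPower, lintegral_dirac' _ hf]
  · rw [lintegral_tsum fun n => ((hf' n).const_mul _).aemeasurable, ← ENNReal.tsum_mul_left]
    refine tsum_congr fun n => ?_
    rw [convPower, Measure.lintegral_conv hf, lintegral_const_mul _ (hf' n), ← mul_assoc,
      ← ENNReal.ofReal_mul h0]
    congr 2
    ring

/-- The defective renewal equation for the distribution function of a geometric compound. -/
theorem compoundGeometric_Iic {ρ : ℝ} (h0 : 0 ≤ ρ) (H : Measure ℝ)
    [IsProbabilityMeasure H] {u : ℝ} (hu : 0 ≤ u) :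
    compoundGeometric ρ H (Iic u) = ENNReal.ofReal (1 - ρ) +
      ENNReal.ofReal ρ * ∫⁻ x, compoundGeometric ρ H (Iic (u - x)) ∂H := by
  have h := compoundGeometric_eq_add h0 H (f := (Iic u).indicator 1)
    (measurable_one.indicator measurableSet_Iic)
  rw [lintegral_indicator_one measurableSet_Iic, indicator_of_mem (by exact hu), Pi.one_apply,
    mul_one] at h
  rw [h]
  congr 2
  refine lintegral_congr fun x => ?_
  rw [← lintegral_indicator_one measurableSet_Iic]
  refine lintegral_congr fun y => ?_
  simp only [indicator, mem_Iic, le_sub_iff_add_le', Pi.one_apply]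

theorem convPower_Iio_zero {H : Measure ℝ} [IsProbabilityMeasure H] (hH : H (Iio 0) = 0) (n : ℕ) :
    convPower H n (Iio 0) = 0 := by
  induction n with
  | zero => simp [convPower]
  | succ n ih =>
    rw [convPower, Measure.conv, Measure.map_apply (by fun_prop) measurableSet_Iio]
    refine measure_mono_null (t := Iio 0 ×ˢ univ ∪ univ ×ˢ Iio 0) ?_ ?_
    · rintro ⟨x, y⟩ hxy
      simp only [mem_preimage, mem_Iio] at hxy
      by_cases hx : x < 0
      · simp [hx]
      · have : y < 0 := by linarith
        simp [this]
    · rw [measure_union_null_iff]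
      simp [Measure.prod_prod, hH, ih]

theorem compoundGeometric_Iic_of_neg {ρ : ℝ} {H : Measure ℝ} [IsProbabilityMeasure H]
    (hH : H (Iio 0) = 0) {u : ℝ} (hu : u < 0) : compoundGeometric ρ H (Iic u) = 0 := by
  refine measure_mono_null (Iic_subset_Iio.2 hu) ?_
  rw [compoundGeometric, Measure.sum_apply _ measurableSet_Iio]
  simp [convPower_Iio_zero hH]

theorem psi_eq_compoundGeometric {ρ : ℝ} (h0 : 0 ≤ ρ) (h1 : ρ < 1) (H : Measure ℝ)
    [IsProbabilityMeasure H] {u : ℝ} (hu : 0 ≤ u) :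
    psi ρ H u = (compoundGeometric ρ H).real (Ioi u) := by
  have hnn : ∀ n : ℕ, 0 ≤ (1 - ρ) * ρ ^ n := fun n =>
    mul_nonneg (by linarith) (pow_nonneg h0 n)
  have hterm : ∀ n : ℕ, (ENNReal.ofReal ((1 - ρ) * ρ ^ n) * convPower H n (Ioi u)).toReal =
      (1 - ρ) * ρ ^ n * (convPower H n).real (Ioi u) := fun n => by
    rw [ENNReal.toReal_mul, ENNReal.toReal_ofReal (hnn n), measureReal_def]
  have hsum : Summable fun n : ℕ => (1 - ρ) * ρ ^ n * (convPower H n).real (Ioi u) :=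
    Summable.of_nonneg_of_le (fun n => mul_nonneg (hnn n) measureReal_nonneg)
      (fun n => mul_le_of_le_one_right (hnn n) measureReal_le_one)
      (hasSum_geometric_weights h0 h1).summable
  rw [measureReal_def, compoundGeometric, Measure.sum_apply _ measurableSet_Ioi]
  simp only [Measure.smul_apply, smul_eq_mul]
  rw [ENNReal.tsum_toReal_eq fun n =>
    ENNReal.mul_ne_top ENNReal.ofReal_ne_top (measure_ne_top _ _)]
  simp only [hterm]
  rw [hsum.tsum_eq_zero_add, psi, ← tsum_mul_left]
  have hz : (convPower H 0).real (Ioi u) = 0 := by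
    simp [convPower, measureReal_def, not_lt.2 hu]
  rw [hz, mul_zero, zero_add]
  exact tsum_congr fun n => by ring

/-! ### The survival function is harmonic for the claim process -/

/-- Integrating `w` against the tail of `B` accumulates `w` up to a point with distribution `B`. -/
theorem lintegral_mul_tail (B : Measure ℝ) [SFinite B] {w : ℝ → ℝ≥0∞} (hw : Measurable w) :
    ∫⁻ x in Ioi 0, w x * B (Ioi x) = ∫⁻ y, ∫⁻ x in Ioc 0 y, w x ∂volume ∂B := by
  have hmeas : Measurable fun z : ℝ × ℝ => w z.1 * (Ioi z.1).indicator (1 : ℝ → ℝ≥0∞) z.2 := by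
    have : (fun z : ℝ × ℝ => w z.1 * (Ioi z.1).indicator (1 : ℝ → ℝ≥0∞) z.2) =
        {z : ℝ × ℝ | z.1 < z.2}.indicator fun z => w z.1 := by
      funext z
      by_cases h : z.1 < z.2 <;> simp [indicator, h]
    rw [this]
    exact (hw.comp measurable_fst).indicator (measurableSet_lt measurable_fst measurable_snd)
  have h1 : ∀ x, w x * B (Ioi x) = ∫⁻ y, w x * (Ioi x).indicator (1 : ℝ → ℝ≥0∞) y ∂B := fun x => by
    rw [lintegral_const_mul _ (measurable_one.indicator measurableSet_Ioi),
      lintegral_indicator_one measurableSet_Ioi]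
  simp only [h1]
  rw [lintegral_lintegral_swap hmeas.aemeasurable]
  refine lintegral_congr fun y => ?_
  rw [← setLIntegral_congr (Ioo_ae_eq_Ioc (a := (0 : ℝ)) (b := y)),
    ← lintegral_indicator measurableSet_Ioi, ← lintegral_indicator measurableSet_Ioo]
  refine lintegral_congr fun x => ?_
  by_cases h0 : 0 < x <;> by_cases h : x < y <;> simp [indicator, h, h0]

theorem lintegral_Ioc_comp_sub (w : ℝ → ℝ≥0∞) (u y : ℝ) :
    ∫⁻ x in Ioc 0 y, w (u - x) = ∫⁻ s in Ioc (u - y) u, w s := by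
  rw [← setLIntegral_congr (Ioo_ae_eq_Ioc (a := (0 : ℝ)) (b := y)),
    ← setLIntegral_congr (Ioo_ae_eq_Ioc (a := u - y) (b := u)),
    ← lintegral_indicator measurableSet_Ioo, ← lintegral_indicator measurableSet_Ioo,
    ← lintegral_sub_left_eq_self ((Ioo (u - y) u).indicator w) u]
  refine lintegral_congr fun x => ?_
  have hx : u - x ∈ Ioo (u - y) u ↔ x ∈ Ioo 0 y := by
    simp only [mem_Ioo]
    constructor <;> rintro ⟨h1, h2⟩ <;> constructor <;> linarith
  by_cases h : x ∈ Ioo 0 y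
  · rw [indicator_of_mem h, indicator_of_mem (hx.2 h)]
  · rw [indicator_of_notMem h, indicator_of_notMem (mt hx.1 h)]

theorem lintegral_Ioc_comp_add (w : ℝ → ℝ≥0∞) (a b c : ℝ) :
    ∫⁻ x in Ioc a b, w (c + x) = ∫⁻ s in Ioc (c + a) (c + b), w s := by
  rw [← lintegral_indicator measurableSet_Ioc, ← lintegral_indicator measurableSet_Ioc,
    ← lintegral_add_left_eq_self ((Ioc (c + a) (c + b)).indicator w) c]
  refine lintegral_congr fun x => ?_
  simp only [indicator, mem_Ioc, add_lt_add_iff_left, add_le_add_iff_left]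

theorem lintegral_Ioc_add (w : ℝ → ℝ≥0∞) {a b c : ℝ} (hab : a ≤ b) (hbc : b ≤ c) :
    ∫⁻ s in Ioc a c, w s = (∫⁻ s in Ioc a b, w s) + ∫⁻ s in Ioc b c, w s := by
  rw [← Ioc_union_Ioc_eq_Ioc hab hbc,
    lintegral_union measurableSet_Ioc (Ioc_disjoint_Ioc_of_le le_rfl)]

theorem expMeasure_Ioi {lam : ℝ} (hlam : 0 < lam) {s : ℝ} (hs : 0 ≤ s) :
    expMeasure lam (Ioi s) = ENNReal.ofReal (Real.exp (-(lam * s))) := by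
  have := isProbabilityMeasure_expMeasure hlam
  have h := cdf_expMeasure_eq hlam s
  rw [if_pos hs, cdf_eq_real] at h
  have h2 := probReal_compl_eq_one_sub (μ := expMeasure lam) (measurableSet_Iic (a := s))
  rw [h, compl_Iic, sub_sub_cancel] at h2
  rw [← h2, measureReal_def, ENNReal.ofReal_toReal (measure_ne_top _ _)]

theorem expMeasure_Iic_zero (lam : ℝ) : expMeasure lam (Iic 0) = 0 := by
  rw [expMeasure, gammaMeasure, withDensity_apply _ measurableSet_Iic,
    ← setLIntegral_congr (Iio_ae_eq_Iic (a := (0 : ℝ))), lintegral_gammaPDF_of_nonpos le_rfl]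

theorem ae_pos_expMeasure (lam : ℝ) : ∀ᵐ t ∂(expMeasure lam), 0 < t := by
  rw [ae_iff]
  simpa [Iic_def] using expMeasure_Iic_zero lam

/-- The hazard rate of the exponential distribution is constant, so the accumulated rate has the
same expectation as the value at the exponential time. -/
theorem lintegral_expMeasure {lam : ℝ} (hlam : 0 < lam) {w : ℝ → ℝ≥0∞} (hw : Measurable w) :
    ENNReal.ofReal lam * ∫⁻ t, ∫⁻ s in Ioc 0 t, w s ∂volume ∂(expMeasure lam) =
      ∫⁻ t, w t ∂(expMeasure lam) := by
  have := isProbabilityMeasure_expMeasure hlam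
  have hpdf : Measurable (gammaPDF 1 lam) := (measurable_gammaPDFReal 1 lam).ennreal_ofReal
  rw [← lintegral_mul_tail _ hw,
    ← lintegral_const_mul _ (by exact hw.mul (measurable_tail (expMeasure lam)))]
  conv_rhs => rw [expMeasure, gammaMeasure, lintegral_withDensity_eq_lintegral_mul _ hpdf hw]
  have hz : ∀ x ∉ Ici (0 : ℝ), (gammaPDF 1 lam * w) x = 0 := fun x hx => by
    rw [Pi.mul_apply, gammaPDF_of_neg (not_le.1 hx), zero_mul]
  have hsupp : ∫⁻ x, (gammaPDF 1 lam * w) x = ∫⁻ x in Ioi 0, (gammaPDF 1 lam * w) x := by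
    rw [setLIntegral_congr (Ioi_ae_eq_Ici (a := (0 : ℝ)))]
    exact (setLIntegral_eq_of_support_subset fun x hx => by
      by_contra h; exact hx (hz x h)).symm
  rw [hsupp]
  refine setLIntegral_congr_fun measurableSet_Ioi fun x (hx : 0 < x) => ?_
  have hg : gammaPDF 1 lam x = ENNReal.ofReal (lam * Real.exp (-(lam * x))) :=
    exponentialPDF_of_nonneg hx.le
  simp only [Pi.mul_apply]
  rw [expMeasure_Ioi hlam hx.le, hg, ENNReal.ofReal_mul hlam.le]
  ring

section Harmonic

variable {B : Measure ℝ} [IsProbabilityMeasure B]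

/-- The renewal equation for the survival function of the model with claim distribution `B`. -/
theorem survival_renewal (hB : B (Iio 0) = 0) (hBint : Integrable (fun x : ℝ => x) B)
    (hm : 0 < mean B) {lam : ℝ} (hlam : 0 ≤ lam) {u : ℝ} (hu : 0 ≤ u) :
    compoundGeometric (lam * mean B) (integratedTail B) (Iic u) =
      ENNReal.ofReal (1 - lam * mean B) + ENNReal.ofReal lam *
        ∫⁻ x in Ioi 0,
          compoundGeometric (lam * mean B) (integratedTail B) (Iic (u - x)) * B (Ioi x) := by
  have := isProbabilityMeasure_integratedTail hB hBint hm
  rw [compoundGeometric_Iic (mul_nonneg hlam hm.le) _ hu, lintegral_integratedTail B hm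
    (by exact (measurable_measure_Iic _).comp (measurable_const.sub measurable_id)),
    ENNReal.ofReal_mul hlam, mul_assoc, ← mul_assoc (ENNReal.ofReal (mean B)),
    ENNReal.mul_inv_cancel (by simpa using hm) ENNReal.ofReal_ne_top, one_mul]

/-- An integrated form of the backward equation `φ' = lam * (φ - E φ(· - X))`. -/
theorem backward_equation (hB : B (Iio 0) = 0) {φ : ℝ → ℝ≥0∞} (hφ : Measurable φ)
    {c lam : ℝ≥0∞}
    (hren : ∀ u, 0 ≤ u → φ u = c + lam * ∫⁻ x in Ioi 0, φ (u - x) * B (Ioi x))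
    {u v : ℝ} (hu : 0 ≤ u) (huv : u ≤ v) :
    φ v + lam * ∫⁻ s in Ioc u v, ∫⁻ y, φ (s - y) ∂B =
      φ u + lam * ∫⁻ s in Ioc u v, φ s := by
  have hmeas : Measurable fun z : ℝ × ℝ => φ (z.1 - z.2) := by fun_prop
  have hren' : ∀ w, 0 ≤ w →
      φ w = c + lam * ∫⁻ y, ∫⁻ s in Ioc (w - y) w, φ s ∂volume ∂B := fun w hw => by
    rw [hren w hw, lintegral_mul_tail B (by fun_prop)]
    simp only [lintegral_Ioc_comp_sub]
  have hIoc : ∀ w, Measurable fun y => ∫⁻ s in Ioc (w - y) w, φ s := fun w => by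
    refine Monotone.measurable fun a b hab => ?_
    exact lintegral_mono_set (Ioc_subset_Ioc_left (by linarith))
  have hswap : ∫⁻ s in Ioc u v, ∫⁻ y, φ (s - y) ∂B =
      ∫⁻ y, ∫⁻ s in Ioc (u - y) (v - y), φ s ∂volume ∂B := by
    rw [lintegral_lintegral_swap hmeas.aemeasurable]
    refine lintegral_congr fun y => ?_
    have h := lintegral_Ioc_comp_add φ u v (-y)
    simpa only [neg_add_eq_sub] using h
  have hconst : ∫⁻ s in Ioc u v, φ s = ∫⁻ _, ∫⁻ s in Ioc u v, φ s ∂volume ∂B := by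
    rw [lintegral_const, measure_univ, mul_one]
  rw [hren' v (hu.trans huv), hren' u hu, hswap, hconst, add_assoc, add_assoc, ← mul_add, ← mul_add,
    ← lintegral_add_left (hIoc v), ← lintegral_add_left (hIoc u)]
  congr 2
  refine lintegral_congr_ae ?_
  filter_upwards [ae_nonneg_of_measure_Iio hB] with y hy
  -- both sides are the integral of `φ` over `(u - y, v]`
  rw [← lintegral_Ioc_add φ (by linarith : u - y ≤ u) huv, add_comm,
    ← lintegral_Ioc_add φ (by linarith : u - y ≤ v - y) (by linarith)]

/-- A bounded solution of the renewal equation is harmonic for the reserve observed at claim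
times. -/
theorem harmonic_of_renewal (hB : B (Iio 0) = 0) {φ : ℝ → ℝ≥0∞} (hφ : Measurable φ)
    (hφ1 : ∀ u, φ u ≤ 1) {c : ℝ≥0∞} {lam : ℝ} (hlam : 0 < lam)
    (hren : ∀ u, 0 ≤ u →
      φ u = c + ENNReal.ofReal lam * ∫⁻ x in Ioi 0, φ (u - x) * B (Ioi x))
    {u : ℝ} (hu : 0 ≤ u) :
    ∫⁻ t, ∫⁻ y, φ (u + t - y) ∂B ∂(expMeasure lam) = φ u := by
  have := isProbabilityMeasure_expMeasure hlam
  have hk : Measurable fun s => ∫⁻ y, φ (s - y) ∂B :=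
    Measurable.lintegral_prod_right' (f := fun z : ℝ × ℝ => φ (z.1 - z.2)) (by fun_prop)
  have hae : ∀ᵐ t ∂(expMeasure lam),
      φ (u + t) + ENNReal.ofReal lam * ∫⁻ s in Ioc 0 t, ∫⁻ y, φ (u + s - y) ∂B =
        φ u + ENNReal.ofReal lam * ∫⁻ s in Ioc 0 t, φ (u + s) := by
    filter_upwards [ae_pos_expMeasure lam] with t ht
    have h := backward_equation hB hφ hren hu (by linarith : u ≤ u + t)
    rw [lintegral_Ioc_comp_add φ 0 t u, lintegral_Ioc_comp_add (fun s => ∫⁻ y, φ (s - y) ∂B) 0 t u,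
      add_zero]
    exact h
  have hφu : Measurable fun t => φ (u + t) := by fun_prop
  have hku : Measurable fun s => ∫⁻ y, φ (u + s - y) ∂B := by
    exact hk.comp (measurable_const_add u)
  have hI : ∀ w : ℝ → ℝ≥0∞, Measurable fun t => ∫⁻ s in Ioc 0 t, w s := fun w =>
    Monotone.measurable fun a b hab => lintegral_mono_set (Ioc_subset_Ioc_right hab)
  have h := lintegral_congr_ae hae
  rw [lintegral_add_left hφu, lintegral_const_mul _ (hI _), lintegral_expMeasure hlam hku,
    lintegral_add_left measurable_const, lintegral_const_mul _ (hI _),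
    lintegral_expMeasure hlam hφu, lintegral_const, measure_univ, mul_one,
    add_comm (φ u)] at h
  refine (ENNReal.add_right_inj ?_).1 h
  refine ne_top_of_le_ne_top ENNReal.one_ne_top ((lintegral_mono fun t => hφ1 (u + t)).trans ?_)
  simp

end Harmonic

/-! ### Gamma distributions -/

theorem gammaMeasure_Iio_zero (a r : ℝ) : gammaMeasure a r (Iio 0) = 0 := by
  rw [gammaMeasure, withDensity_apply _ measurableSet_Iio, lintegral_gammaPDF_of_nonpos le_rfl]

theorem lintegral_ofReal_gammaMeasure {a r : ℝ} (ha : 0 < a) (hr : 0 < r) :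
    ∫⁻ x, ENNReal.ofReal x ∂(gammaMeasure a r) = ENNReal.ofReal (a / r) := by
  have hpdf : ∀ b, Measurable (gammaPDF b r) := fun b =>
    (measurable_gammaPDFReal b r).ennreal_ofReal
  rw [gammaMeasure, lintegral_withDensity_eq_lintegral_mul _ (hpdf a) ENNReal.measurable_ofReal]
  -- `x` times the density of shape `a` is `a / r` times the density of shape `a + 1`
  have h : ∀ x, (gammaPDF a r * ENNReal.ofReal) x =
      ENNReal.ofReal (a / r) * gammaPDF (a + 1) r x := fun x => by
    rw [Pi.mul_apply]
    rcases lt_or_ge x 0 with hx | hx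
    · rw [gammaPDF_of_neg hx, gammaPDF_of_neg hx, zero_mul, mul_zero]
    rcases hx.eq_or_lt with rfl | hx
    · rw [gammaPDF_of_nonneg le_rfl, gammaPDF_of_nonneg le_rfl, add_sub_cancel_right,
        Real.zero_rpow ha.ne']
      simp
    rw [gammaPDF_of_nonneg hx.le, gammaPDF_of_nonneg hx.le, ← ENNReal.ofReal_mul' hx.le,
      ← ENNReal.ofReal_mul (by positivity), Real.Gamma_add_one ha.ne', add_sub_cancel_right,
      Real.rpow_add_one hr.ne', Real.rpow_sub_one hx.ne']
    congr 1
    have := (Real.Gamma_pos_of_pos ha).ne'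
    field_simp
  simp only [h]
  rw [lintegral_const_mul _ (hpdf _), lintegral_gammaPDF_eq_one (by linarith) hr, mul_one]

theorem integrable_gammaMeasure {a r : ℝ} (ha : 0 < a) (hr : 0 < r) :
    Integrable (fun x : ℝ => x) (gammaMeasure a r) := by
  refine ⟨measurable_id.aestronglyMeasurable, ?_⟩
  rw [hasFiniteIntegral_iff_ofReal (ae_nonneg_of_measure_Iio (gammaMeasure_Iio_zero a r)),
    lintegral_ofReal_gammaMeasure ha hr]
  exact ENNReal.ofReal_lt_top

theorem mean_gammaMeasure {a r : ℝ} (ha : 0 < a) (hr : 0 < r) :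
    mean (gammaMeasure a r) = a / r := by
  rw [mean, integral_eq_lintegral_of_nonneg_ae
    (ae_nonneg_of_measure_Iio (gammaMeasure_Iio_zero a r)) measurable_id.aestronglyMeasurable,
    lintegral_ofReal_gammaMeasure ha hr, ENNReal.toReal_ofReal (by positivity)]

/-! ### The Pollaczek–Khinchine formula -/

section Walk

variable {Ω : Type*}

/-- The random walk `∑_{k < n} (T_k - X_k)` of the reserve at claim times, started at zero. -/
noncomputable def claimWalk (T X : ℕ → Ω → ℝ) (n : ℕ) (ω : Ω) : ℝ :=
  ∑ k ∈ Finset.range n, (T k ω - X k ω)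

/-- The reserve at the `n`-th claim time, stopped when it becomes negative. -/
noncomputable def stoppedReserve (T X : ℕ → Ω → ℝ) (u : ℝ) : ℕ → Ω → ℝ
  | 0, _ => u
  | n + 1, ω => if 0 ≤ stoppedReserve T X u n ω then
      stoppedReserve T X u n ω + T n ω - X n ω else stoppedReserve T X u n ω

theorem stoppedReserve_eq_claimWalk (T X : ℕ → Ω → ℝ) (u : ℝ) (n : ℕ) (ω : Ω)
    (h : ∀ m < n, 0 ≤ u + claimWalk T X m ω) :
    stoppedReserve T X u n ω = u + claimWalk T X n ω := by
  induction n with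
  | zero => simp [stoppedReserve, claimWalk]
  | succ n ih =>
    have ih' := ih fun m hm => h m (by omega)
    rw [stoppedReserve, ih', if_pos (h n (by omega)), claimWalk, claimWalk, Finset.sum_range_succ]
    ring

theorem stoppedReserve_neg (T X : ℕ → Ω → ℝ) (u : ℝ) (n : ℕ) (ω : Ω)
    (h : stoppedReserve T X u n ω < 0) (m : ℕ) (hm : n ≤ m) : stoppedReserve T X u m ω < 0 := by
  induction m, hm using Nat.le_induction with
  | base => exact h
  | succ m _ ih => rwa [stoppedReserve, if_neg (not_le.2 ih)]

/-- Ruin can only occur at a claim time. -/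
theorem exists_reserve_neg_iff (T X : ℕ → Ω → ℝ) {u : ℝ} (hu : 0 ≤ u) (ω : Ω)
    (hT : ∀ k, 0 < T k ω) :
    (∃ t : ℝ, 0 < t ∧ reserve T X u t ω < 0) ↔ ∃ n, u + claimWalk T X n ω < 0 := by
  have hmono : StrictMono fun n => arrivalTime T n ω := strictMono_nat_of_lt_succ fun n => by
    rw [arrivalTime, arrivalTime, Finset.sum_range_succ _ (n + 1)]
    linarith [hT (n + 1)]
  have hwalk : ∀ n, claimWalk T X (n + 1) ω =
      arrivalTime T n ω - ∑ k ∈ Finset.range (n + 1), X k ω := fun n => by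
    rw [claimWalk, Finset.sum_sub_distrib, arrivalTime]
  constructor
  · rintro ⟨t, ht, hneg⟩
    rw [reserve] at hneg
    rcases hN : claimCount T t ω with _ | n
    · rw [hN] at hneg
      simp only [Finset.range_zero, Finset.sum_empty] at hneg
      linarith
    · refine ⟨n + 1, ?_⟩
      rw [hN] at hneg
      have hle : arrivalTime T n ω ≤ t := by
        by_contra hlt
        have hsub : {m : ℕ | arrivalTime T m ω ≤ t} ⊆ ↑(Finset.range n) := fun m hm => by
          simp only [Finset.coe_range, mem_Iio]
          exact hmono.lt_iff_lt.1 (lt_of_le_of_lt hm (not_le.1 hlt))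
        have hcard := Set.ncard_le_ncard hsub (Finset.finite_toSet _)
        rw [Set.ncard_coe_finset, Finset.card_range] at hcard
        rw [claimCount] at hN
        omega
      rw [hwalk]
      linarith
  · rintro ⟨n, hn⟩
    rcases n with _ | n
    · simp only [claimWalk, Finset.range_zero, Finset.sum_empty] at hn
      linarith
    · refine ⟨arrivalTime T n ω, Finset.sum_pos (fun k _ => hT k) (by simp), ?_⟩
      have hset : {m : ℕ | arrivalTime T m ω ≤ arrivalTime T n ω} = ↑(Finset.range (n + 1)) := by
        ext m
        simp [hmono.le_iff_le]
      have hcount : claimCount T (arrivalTime T n ω) ω = n + 1 := by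
        rw [claimCount, hset, Set.ncard_coe_finset, Finset.card_range]
      rw [hwalk] at hn
      rw [reserve, hcount]
      linarith

/-- The stopped reserve after `n` claims is a function of the first `n` interarrival times and
claims. -/
theorem measurable_stoppedReserve_history (T X : ℕ → Ω → ℝ) (u : ℝ) (n : ℕ) :
    Measurable[⨆ i ∈ {i : ℕ ⊕ ℕ | Sum.elim id id i < n},
      MeasurableSpace.comap (Sum.elim T X i) inferInstance] (stoppedReserve T X u n) := by
  induction n with
  | zero => exact @measurable_const _ _ _ (_) u
  | succ n ih =>
    set m' := ⨆ i ∈ {i : ℕ ⊕ ℕ | Sum.elim id id i < n + 1},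
      MeasurableSpace.comap (Sum.elim T X i) inferInstance with hm'
    have hle : ∀ i : ℕ ⊕ ℕ, Sum.elim id id i < n + 1 → Measurable[m'] (Sum.elim T X i) :=
      fun i hi => Measurable.mono (comap_measurable (Sum.elim T X i))
        (le_iSup₂_of_le (f := fun (i : ℕ ⊕ ℕ) (_ : i ∈ {i : ℕ ⊕ ℕ | Sum.elim id id i < n + 1}) =>
          MeasurableSpace.comap (Sum.elim T X i) inferInstance) i hi le_rfl) le_rfl
    have hV : Measurable[m'] (stoppedReserve T X u n) :=
      ih.mono (biSup_mono fun i hi => lt_trans hi (Nat.lt_succ_self n)) le_rfl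
    have hTn : Measurable[m'] (T n) := hle (Sum.inl n) (by simp)
    have hXn : Measurable[m'] (X n) := hle (Sum.inr n) (by simp)
    exact Measurable.ite (measurableSet_le measurable_const hV) ((hV.add hTn).sub hXn) hV

end Walk

namespace IsCramerLundberg

variable {Ω : Type*} [MeasurableSpace Ω] {P : Measure Ω} {lam : ℝ} {B : Measure ℝ} {T X : ℕ → Ω → ℝ}

theorem measurable_elim (h : IsCramerLundberg P lam B T X) (i : ℕ ⊕ ℕ) :
    Measurable (Sum.elim T X i) := by
  rcases i with k | k
  · exact h.measurable_interarrival k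
  · exact h.measurable_claim k

theorem measurable_stoppedReserve (h : IsCramerLundberg P lam B T X) (u : ℝ) (n : ℕ) :
    Measurable (stoppedReserve T X u n) := by
  induction n with
  | zero => exact measurable_const
  | succ n ih =>
    exact Measurable.ite (measurableSet_le measurable_const ih)
      ((ih.add (h.measurable_interarrival n)).sub (h.measurable_claim n)) ih

theorem indepFun_stoppedReserve (h : IsCramerLundberg P lam B T X) (u : ℝ) (n : ℕ) :
    IndepFun (stoppedReserve T X u n) (fun ω => (T n ω, X n ω)) P := by
  rw [IndepFun_iff_Indep]
  have hdisj : Disjoint {i : ℕ ⊕ ℕ | Sum.elim id id i < n} {i : ℕ ⊕ ℕ | Sum.elim id id i = n} :=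
    Set.disjoint_left.2 fun i (hi : _ < n) (hi' : _ = n) => by omega
  have hind := indep_iSup_of_disjoint (fun i => (h.measurable_elim i).comap_le) h.indep.iIndep hdisj
  refine indep_of_indep_of_le_left (indep_of_indep_of_le_right hind ?_)
    (measurable_stoppedReserve_history T X u n).comap_le
  set m' := ⨆ i ∈ {i : ℕ ⊕ ℕ | Sum.elim id id i = n},
    MeasurableSpace.comap (Sum.elim T X i) inferInstance
  have hle : ∀ i : ℕ ⊕ ℕ, Sum.elim id id i = n → Measurable[m'] (Sum.elim T X i) :=
    fun i hi => Measurable.mono (comap_measurable (Sum.elim T X i))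
      (le_iSup₂_of_le (f := fun (i : ℕ ⊕ ℕ) (_ : i ∈ {i : ℕ ⊕ ℕ | Sum.elim id id i = n}) =>
        MeasurableSpace.comap (Sum.elim T X i) inferInstance) i hi le_rfl) le_rfl
  have hTn : Measurable[m'] (T n) := hle (Sum.inl n) rfl
  have hXn : Measurable[m'] (X n) := hle (Sum.inr n) rfl
  exact (hTn.prodMk hXn).comap_le

variable [IsProbabilityMeasure P]

theorem map_pair (h : IsCramerLundberg P lam B T X) (n : ℕ) :
    P.map (fun ω => (T n ω, X n ω)) = (expMeasure lam).prod B := by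
  have hind : IndepFun (T n) (X n) P :=
    h.indep.indepFun (i := Sum.inl n) (j := Sum.inr n) (by simp)
  rw [(indepFun_iff_map_prod_eq_prod_map_map (h.measurable_interarrival n).aemeasurable
    (h.measurable_claim n).aemeasurable).1 hind, h.map_interarrival, h.map_claim]

/-- A harmonic function of the reserve is preserved in mean until ruin. -/
theorem lintegral_stoppedReserve (h : IsCramerLundberg P lam B T X) [SFinite B] (hlam : 0 < lam)
    {φ : ℝ → ℝ≥0∞} (hφ : Measurable φ)
    (hharm : ∀ v, 0 ≤ v → ∫⁻ t, ∫⁻ y, φ (v + t - y) ∂B ∂(expMeasure lam) = φ v)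
    (u : ℝ) (n : ℕ) : ∫⁻ ω, φ (stoppedReserve T X u n ω) ∂P = φ u := by
  have := isProbabilityMeasure_expMeasure hlam
  have : IsProbabilityMeasure B := by
    rw [← h.map_claim 0]
    exact Measure.isProbabilityMeasure_map (h.measurable_claim 0).aemeasurable
  induction n with
  | zero => simp [stoppedReserve]
  | succ n ih =>
    have hV := h.measurable_stoppedReserve u n
    have hTX : Measurable fun ω => (T n ω, X n ω) :=
      (h.measurable_interarrival n).prodMk (h.measurable_claim n)
    have hg : Measurable fun z : ℝ × ℝ × ℝ =>
        φ (if 0 ≤ z.1 then z.1 + z.2.1 - z.2.2 else z.1) :=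
      hφ.comp (Measurable.ite (measurableSet_le measurable_const measurable_fst) (by fun_prop)
        (by fun_prop))
    have hmap := (indepFun_iff_map_prod_eq_prod_map_map hV.aemeasurable hTX.aemeasurable).1
      (h.indepFun_stoppedReserve u n)
    have hstep : ∫⁻ ω, φ (stoppedReserve T X u (n + 1) ω) ∂P =
        ∫⁻ z, φ (if 0 ≤ z.1 then z.1 + z.2.1 - z.2.2 else z.1)
          ∂(P.map fun ω => (stoppedReserve T X u n ω, (T n ω, X n ω))) := by
      rw [lintegral_map hg (hV.prodMk hTX)]
      rfl
    rw [hstep, hmap, h.map_pair, lintegral_prod _ hg.aemeasurable, lintegral_map ?_ hV, ← ih]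
    swap
    · exact Measurable.lintegral_prod_right' hg
    refine lintegral_congr fun ω => ?_
    dsimp only
    split_ifs with hv
    · rw [← hharm _ hv, lintegral_prod _ (by fun_prop)]
    · simp

theorem tendsto_claimWalk (h : IsCramerLundberg P lam B T X) (hlam : 0 < lam)
    (hBint : Integrable (fun x : ℝ => x) B) (hρ : lam * mean B < 1) :
    ∀ᵐ ω ∂P, Tendsto (fun n => claimWalk T X n ω) atTop atTop := by
  have hT : ∀ k, Integrable (T k) P := fun k => by
    refine (integrable_map_measure (f := T k) (g := fun x : ℝ => x)
      measurable_id.aestronglyMeasurable (h.measurable_interarrival k).aemeasurable).1 ?_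
    rw [h.map_interarrival]
    exact integrable_gammaMeasure one_pos hlam
  have hX : ∀ k, Integrable (X k) P := fun k => by
    refine (integrable_map_measure (f := X k) (g := fun x : ℝ => x)
      measurable_id.aestronglyMeasurable (h.measurable_claim k).aemeasurable).1 ?_
    rw [h.map_claim]
    exact hBint
  have hpair : ∀ k, Measurable fun ω => (T k ω, X k ω) := fun k =>
    (h.measurable_interarrival k).prodMk (h.measurable_claim k)
  have hsub : Measurable fun z : ℝ × ℝ => z.1 - z.2 := by fun_prop
  have hslln := strong_law_ae_real (μ := P) (fun k ω => T k ω - X k ω) ((hT 0).sub (hX 0))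
    (fun i j hij => (h.indep.indepFun_prodMk_prodMk h.measurable_elim (Sum.inl i) (Sum.inr i)
      (Sum.inl j) (Sum.inr j) (by simpa using hij) (by simp) (by simp)
      (by simpa using hij)).comp hsub hsub)
    (fun k => (IdentDistrib.mk (hpair k).aemeasurable (hpair 0).aemeasurable
      (by rw [h.map_pair, h.map_pair])).comp hsub)
  have hmean : ∫ ω, (T 0 ω - X 0 ω) ∂P = 1 / lam - mean B := by
    have hT0 : ∫ ω, T 0 ω ∂P = 1 / lam := by
      rw [← mean_gammaMeasure one_pos hlam, mean, ← expMeasure, ← h.map_interarrival 0,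
        integral_map (f := fun x : ℝ => x) (h.measurable_interarrival 0).aemeasurable
          measurable_id.aestronglyMeasurable]
    have hX0 : ∫ ω, X 0 ω ∂P = mean B := by
      rw [mean, ← h.map_claim 0,
        integral_map (f := fun x : ℝ => x) (h.measurable_claim 0).aemeasurable
          measurable_id.aestronglyMeasurable]
    rw [integral_sub (hT 0) (hX 0), hT0, hX0]
  -- the net profit condition: premiums exceed claims on average
  have hpos : 0 < 1 / lam - mean B := by
    rw [sub_pos, lt_div_iff₀ hlam, mul_comm]
    exact hρ
  filter_upwards [hslln] with ω hω
  rw [hmean] at hω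
  refine (hω.pos_mul_atTop hpos tendsto_natCast_atTop_atTop).congr' ?_
  filter_upwards [eventually_gt_atTop 0] with n hn
  have : (n : ℝ) ≠ 0 := by positivity
  rw [div_mul_cancel₀ _ this, claimWalk]

/-- **Pollaczek–Khinchine formula**: the ruin probability is the tail of a geometric compound of
integrated tail distributions. -/
theorem ruinProbability_eq_psi (h : IsCramerLundberg P lam B T X) [IsProbabilityMeasure B]
    (hlam : 0 < lam) (hB : B (Iio 0) = 0) (hBint : Integrable (fun x : ℝ => x) B)
    (hm : 0 < mean B) (hρ : lam * mean B < 1) {u : ℝ} (hu : 0 ≤ u) :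
    ruinProbability P T X u = psi (lam * mean B) (integratedTail B) u := by
  have hH := isProbabilityMeasure_integratedTail hB hBint hm
  have hρ0 : 0 ≤ lam * mean B := mul_nonneg hlam.le hm.le
  set M := compoundGeometric (lam * mean B) (integratedTail B) with hM
  have hMprob : IsProbabilityMeasure M := isProbabilityMeasure_compoundGeometric hρ0 hρ _
  have hφ : Measurable fun v => M (Iic v) := measurable_measure_Iic M
  have hlint : ∀ n, ∫⁻ ω, M (Iic (stoppedReserve T X u n ω)) ∂P = M (Iic u) :=
    h.lintegral_stoppedReserve hlam hφ (fun v hv =>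
      harmonic_of_renewal hB hφ (fun _ => prob_le_one) hlam
        (fun w hw => survival_renewal hB hBint hm hlam.le hw) hv) u
  set S : Set Ω := {ω | ∃ n, u + claimWalk T X n ω < 0} with hS
  have hSmeas : MeasurableSet S := by
    have : S = ⋃ n, {ω | u + claimWalk T X n ω < 0} := by ext; simp [hS]
    rw [this]
    refine MeasurableSet.iUnion fun n => measurableSet_lt ?_ measurable_const
    exact (Finset.measurable_fun_sum _ fun k _ =>
      (h.measurable_interarrival k).sub (h.measurable_claim k)).const_add u
  -- the survival function along the stopped reserve converges to the indicator of survival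
  have hlim : Tendsto (fun n => ∫⁻ ω, M (Iic (stoppedReserve T X u n ω)) ∂P) atTop
      (𝓝 (∫⁻ ω, Sᶜ.indicator 1 ω ∂P)) := by
    refine tendsto_lintegral_of_dominated_convergence (fun _ => 1)
      (fun n => hφ.comp (h.measurable_stoppedReserve u n))
      (fun n => Eventually.of_forall fun ω => prob_le_one) (by simp) ?_
    filter_upwards [h.tendsto_claimWalk hlam hBint hρ] with ω hω
    by_cases hωS : ω ∈ S
    · rw [indicator_of_notMem (by simpa using hωS)]
      have hfirst : stoppedReserve T X u (Nat.find hωS) ω < 0 := by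
        rw [stoppedReserve_eq_claimWalk T X u _ ω fun m hm => not_lt.1 (Nat.find_min hωS hm)]
        exact Nat.find_spec hωS
      refine tendsto_const_nhds.congr' ?_
      filter_upwards [eventually_ge_atTop (Nat.find hωS)] with n hn
      exact (compoundGeometric_Iic_of_neg (integratedTail_Iio_zero B)
        (stoppedReserve_neg T X u _ ω hfirst n hn)).symm
    · rw [indicator_of_mem (by simpa using hωS), Pi.one_apply, ← measure_univ (μ := M)]
      have hV : ∀ n, stoppedReserve T X u n ω = u + claimWalk T X n ω := fun n =>
        stoppedReserve_eq_claimWalk T X u n ω fun m _ => not_lt.1 fun hneg => hωS ⟨m, hneg⟩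
      simp only [hV]
      exact (tendsto_measure_Iic_atTop M).comp (tendsto_atTop_add_const_left _ u hω)
  simp only [hlint] at hlim
  have hsurv : P Sᶜ = M (Iic u) := by
    rw [← lintegral_indicator_one hSmeas.compl]
    exact tendsto_nhds_unique hlim tendsto_const_nhds |>.symm ▸ rfl
  have hTpos : ∀ᵐ ω ∂P, ∀ k, 0 < T k ω := ae_all_iff.2 fun k => by
    have := ae_pos_expMeasure lam
    rw [← h.map_interarrival k] at this
    exact ae_of_ae_map (h.measurable_interarrival k).aemeasurable this
  have hruin : ({ω | ∃ t : ℝ, 0 < t ∧ reserve T X u t ω < 0} : Set Ω) =ᵐ[P] S := by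
    filter_upwards [hTpos] with ω hω
    exact propext (exists_reserve_neg_iff T X hu ω hω)
  rw [psi_eq_compoundGeometric hρ0 hρ _ hu, ← hM, ← compl_Iic,
    probReal_compl_eq_one_sub measurableSet_Iic, measureReal_def M, ← hsurv, ← measureReal_def,
    probReal_compl_eq_one_sub hSmeas, sub_sub_cancel, ruinProbability]
  exact measureReal_congr hruin

end IsCramerLundberg

/-! ### Poisson weights and Erlang tails -/

/-- The Poisson probability `y ^ n * exp (-y) / n!`. -/
noncomputable def poissonWeight (n : ℕ) (y : ℝ) : ℝ :=
  y ^ n * Real.exp (-y) / (n.factorial : ℝ)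

theorem poissonWeight_nonneg (n : ℕ) {y : ℝ} (hy : 0 ≤ y) : 0 ≤ poissonWeight n y := by
  unfold poissonWeight; positivity

theorem hasSum_pow_div_factorial (x : ℝ) :
    HasSum (fun n : ℕ => x ^ n / (n.factorial : ℝ)) (Real.exp x) := by
  rw [Real.exp_eq_exp_ℝ]
  exact NormedSpace.expSeries_div_hasSum_exp x

theorem hasSum_poissonWeight (y : ℝ) : HasSum (fun n => poissonWeight n y) 1 := by
  have h := (hasSum_pow_div_factorial y).mul_right (Real.exp (-y))
  rw [← Real.exp_add, add_neg_cancel, Real.exp_zero] at h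
  refine h.congr_fun fun n => ?_
  rw [poissonWeight]
  ring

theorem continuous_poissonWeight (n : ℕ) : Continuous (poissonWeight n) := by
  unfold poissonWeight; fun_prop

/-- Poisson thinning: keeping each of `N` points, `N` Poisson with parameter `y`, with probability
`q` leaves a Poisson number with parameter `q * y`. -/
theorem hasSum_binPmf_mul_poissonWeight (k : ℕ) (q y : ℝ) :
    HasSum (fun n => binPmf k n q * poissonWeight n y) (poissonWeight k (q * y)) := by
  have hzero : ∑ i ∈ Finset.range k, binPmf k i q * poissonWeight i y = 0 :=
    Finset.sum_eq_zero fun i hi => by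
      rw [binPmf, Nat.choose_eq_zero_of_lt (Finset.mem_range.1 hi)]
      simp
  have hshift := hasSum_nat_add_iff (f := fun n => binPmf k n q * poissonWeight n y)
    (g := poissonWeight k (q * y)) k
  rw [hzero, add_zero] at hshift
  refine hshift.1 ?_
  have h := (hasSum_pow_div_factorial ((1 - q) * y)).mul_left
    ((q * y) ^ k / (k.factorial : ℝ) * Real.exp (-y))
  have hlim : (q * y) ^ k / (k.factorial : ℝ) * Real.exp (-y) * Real.exp ((1 - q) * y) =
      poissonWeight k (q * y) := by
    rw [mul_assoc, ← Real.exp_add, poissonWeight, show -y + (1 - q) * y = -(q * y) by ring]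
    ring
  rw [hlim] at h
  refine h.congr_fun fun n => ?_
  have hc : ((n + k).choose k : ℝ) * n.factorial * k.factorial = (n + k).factorial := by
    exact_mod_cast Nat.add_choose_mul_factorial_mul_factorial n k
  have h1 : (n.factorial : ℝ) ≠ 0 := by positivity
  have h2 : (k.factorial : ℝ) ≠ 0 := by positivity
  have h3 : ((n + k).choose k : ℝ) ≠ 0 := by
    exact_mod_cast (Nat.choose_pos (Nat.le_add_left k n)).ne'
  rw [binPmf, poissonWeight, ← hc, Nat.add_sub_cancel, mul_pow, mul_pow, pow_add]
  field_simp

theorem hasDerivAt_poissonWeight_zero (y : ℝ) :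
    HasDerivAt (poissonWeight 0) (-poissonWeight 0 y) y := by
  have h : poissonWeight 0 = fun y => Real.exp (-y) := by
    funext y; simp [poissonWeight]
  rw [h]
  simpa using (hasDerivAt_neg y).exp

theorem hasDerivAt_poissonWeight_succ (n : ℕ) (y : ℝ) :
    HasDerivAt (poissonWeight (n + 1)) (poissonWeight n y - poissonWeight (n + 1) y) y := by
  have h := ((hasDerivAt_pow (n + 1) y).mul (hasDerivAt_neg y).exp).div_const
    ((n + 1).factorial : ℝ)
  refine h.congr_deriv ?_
  have h1 : (n.factorial : ℝ) ≠ 0 := by positivity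
  have h2 : (n : ℝ) + 1 ≠ 0 := by positivity
  rw [poissonWeight, poissonWeight, Nat.factorial_succ]
  push_cast
  field_simp
  ring

theorem hasDerivAt_sum_poissonWeight (n : ℕ) (y : ℝ) :
    HasDerivAt (fun y => ∑ k ∈ Finset.range (n + 1), poissonWeight k y)
      (-poissonWeight n y) y := by
  induction n with
  | zero => simpa using hasDerivAt_poissonWeight_zero y
  | succ n ih =>
    simp only [Finset.sum_range_succ _ (n + 1)]
    exact (ih.add (hasDerivAt_poissonWeight_succ n y)).congr_deriv (by ring)

theorem sum_poissonWeight_zero (n : ℕ) :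
    ∑ k ∈ Finset.range (n + 1), poissonWeight k 0 = 1 := by
  rw [Finset.sum_range_succ']
  simp [poissonWeight]

/-- The tail of an Erlang distribution is a partial sum of Poisson weights. -/
theorem gammaMeasure_nat_Ioi {n : ℕ} {r : ℝ} (hr : 0 < r) {x : ℝ} (hx : 0 ≤ x) :
    gammaMeasure ((n + 1 : ℕ) : ℝ) r (Ioi x) =
      ENNReal.ofReal (∑ k ∈ Finset.range (n + 1), poissonWeight k (r * x)) := by
  have hn : (0 : ℝ) < ((n + 1 : ℕ) : ℝ) := by positivity
  have := isProbabilityMeasure_gammaMeasure hn hr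
  have hpdf : ∀ t, 0 ≤ t → gammaPDFReal ((n + 1 : ℕ) : ℝ) r t = r * poissonWeight n (r * t) :=
    fun t ht => by
      rw [gammaPDFReal, if_pos ht, poissonWeight]
      push_cast
      rw [Real.Gamma_nat_eq_factorial, add_sub_cancel_right, Real.rpow_natCast,
        Real.rpow_add_one hr.ne', Real.rpow_natCast, mul_pow]
      ring
  have hcont : Continuous fun t => r * poissonWeight n (r * t) := by
    have := continuous_poissonWeight n
    fun_prop
  have hftc : ∫ t in (0 : ℝ)..x, r * poissonWeight n (r * t) =
      1 - ∑ k ∈ Finset.range (n + 1), poissonWeight k (r * x) := by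
    have hd : ∀ t ∈ uIcc 0 x,
        HasDerivAt (fun t => -∑ k ∈ Finset.range (n + 1), poissonWeight k (r * t))
          (r * poissonWeight n (r * t)) t := fun t _ => by
      have h := ((hasDerivAt_sum_poissonWeight n (r * t)).comp t
        ((hasDerivAt_id t).const_mul r)).neg
      exact h.congr_deriv (by ring)
    rw [intervalIntegral.integral_eq_sub_of_hasDerivAt hd (hcont.intervalIntegrable _ _), mul_zero,
      sum_poissonWeight_zero]
    ring
  have hcdf : (gammaMeasure ((n + 1 : ℕ) : ℝ) r).real (Iic x) =
      1 - ∑ k ∈ Finset.range (n + 1), poissonWeight k (r * x) := by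
    rw [← hftc, intervalIntegral.integral_of_le hx, integral_eq_lintegral_of_nonneg_ae,
      measureReal_def]
    · rw [gammaMeasure, withDensity_apply _ measurableSet_Iic,
        lintegral_Iic_eq_lintegral_Iio_add_Icc _ hx, lintegral_gammaPDF_of_nonpos le_rfl, zero_add,
        ← setLIntegral_congr (Ioc_ae_eq_Icc (a := (0 : ℝ)) (b := x))]
      congr 1
      refine setLIntegral_congr_fun measurableSet_Ioc fun t ht => ?_
      rw [gammaPDF, hpdf t ht.1.le]
    · filter_upwards [ae_restrict_mem measurableSet_Ioc] with t ht
      exact mul_nonneg hr.le (poissonWeight_nonneg n (mul_nonneg hr.le ht.1.le))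
    · exact hcont.aestronglyMeasurable
  have htail := probReal_compl_eq_one_sub (μ := gammaMeasure ((n + 1 : ℕ) : ℝ) r)
    (measurableSet_Iic (a := x))
  rw [hcdf, sub_sub_cancel, compl_Iic] at htail
  rw [← htail, measureReal_def, ENNReal.ofReal_toReal (measure_ne_top _ _)]

theorem integral_sub_pow_mul_pow (n i : ℕ) (u : ℝ) :
    ∫ x in (0 : ℝ)..u, (u - x) ^ n * x ^ i =
      n.factorial * i.factorial / (n + i + 1).factorial * u ^ (n + i + 1) := by
  induction n generalizing i with
  | zero =>
    have h1 : (i.factorial : ℝ) ≠ 0 := by positivity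
    have h2 : (i : ℝ) + 1 ≠ 0 := by positivity
    simp only [pow_zero, one_mul, integral_pow, zero_add, Nat.factorial_succ, Nat.factorial_zero]
    push_cast
    rw [zero_pow (by omega)]
    field_simp
    ring
  | succ n ih =>
    have hu : ∀ x ∈ uIcc 0 u, HasDerivAt (fun x => (u - x) ^ (n + 1))
        (-((n + 1) * (u - x) ^ n)) x := fun x _ => by
      have h := ((hasDerivAt_id x).const_sub u).pow (n + 1)
      refine h.congr_deriv ?_
      push_cast
      simp only [id]
      ring
    have hv : ∀ x ∈ uIcc 0 u, HasDerivAt (fun x => x ^ (i + 1) / ((i : ℝ) + 1)) (x ^ i) x :=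
      fun x _ => by
        have h2 : (i : ℝ) + 1 ≠ 0 := by positivity
        refine ((hasDerivAt_pow (i + 1) x).div_const ((i : ℝ) + 1)).congr_deriv ?_
        push_cast
        field_simp
    rw [intervalIntegral.integral_mul_deriv_eq_deriv_mul hu hv
      (Continuous.intervalIntegrable (by fun_prop) _ _)
      (Continuous.intervalIntegrable (by fun_prop) _ _)]
    have h : ∀ x : ℝ, -((n + 1) * (u - x) ^ n) * (x ^ (i + 1) / ((i : ℝ) + 1)) =
        -((n + 1) / (i + 1)) * ((u - x) ^ n * x ^ (i + 1)) := fun x => by ring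
    simp only [h]
    rw [intervalIntegral.integral_const_mul, ih (i + 1), sub_self, zero_pow (by omega),
      zero_pow (by omega), show n + 1 + i + 1 = n + (i + 1) + 1 by ring,
      Nat.factorial_succ n, Nat.factorial_succ i]
    have h2 : (i : ℝ) + 1 ≠ 0 := by positivity
    push_cast
    field_simp
    ring

/-- The convolution of two Erlang densities of the same rate. -/
theorem lintegral_poissonWeight_mul {a : ℝ} (ha : 0 < a) {u : ℝ} (hu : 0 ≤ u) (n i : ℕ) :
    ∫⁻ x in Ioc 0 u, ENNReal.ofReal (poissonWeight n (a * (u - x))) *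
        ENNReal.ofReal (poissonWeight i (a * x)) =
      ENNReal.ofReal (poissonWeight (n + i + 1) (a * u) / a) := by
  have hcont : Continuous fun x => poissonWeight n (a * (u - x)) * poissonWeight i (a * x) := by
    have h1 := continuous_poissonWeight n
    have h2 := continuous_poissonWeight i
    fun_prop
  have hnn : ∀ x ∈ Ioc 0 u, 0 ≤ poissonWeight n (a * (u - x)) := fun x hx =>
    poissonWeight_nonneg _ (mul_nonneg ha.le (by linarith [hx.2]))
  have hmul : ∫⁻ x in Ioc 0 u, ENNReal.ofReal (poissonWeight n (a * (u - x))) *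
        ENNReal.ofReal (poissonWeight i (a * x)) =
      ∫⁻ x in Ioc 0 u, ENNReal.ofReal
        (poissonWeight n (a * (u - x)) * poissonWeight i (a * x)) :=
    setLIntegral_congr_fun measurableSet_Ioc fun x hx => (ENNReal.ofReal_mul (hnn x hx)).symm
  rw [hmul, ← ofReal_integral_eq_lintegral_ofReal, ← intervalIntegral.integral_of_le hu]
  · congr 1
    have h : ∀ x, poissonWeight n (a * (u - x)) * poissonWeight i (a * x) =
        a ^ (n + i) * Real.exp (-(a * u)) / (n.factorial * i.factorial) *
          ((u - x) ^ n * x ^ i) := fun x => by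
      rw [poissonWeight, poissonWeight,
        show -(a * u) = -(a * (u - x)) + -(a * x) by ring, Real.exp_add, mul_pow, mul_pow]
      ring
    simp only [h]
    rw [intervalIntegral.integral_const_mul, integral_sub_pow_mul_pow, poissonWeight]
    have h1 : (n.factorial : ℝ) ≠ 0 := by positivity
    have h2 : (i.factorial : ℝ) ≠ 0 := by positivity
    field_simp
    ring
  · exact (intervalIntegrable_iff_integrableOn_Ioc_of_le hu).1 (hcont.intervalIntegrable _ _)
  · filter_upwards [ae_restrict_mem measurableSet_Ioc] with x hx
    exact mul_nonneg (hnn x hx) (poissonWeight_nonneg _ (mul_nonneg ha.le hx.1.le))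

/-! ### The binomial mixtures -/

theorem sum_binPmf_eq_one {m n : ℕ} (h : n < m) (q : ℝ) :
    ∑ k ∈ Finset.range m, binPmf k n q = 1 := by
  have hfull : ∑ k ∈ Finset.range (n + 1), binPmf k n q = 1 := by
    have h := add_pow q (1 - q) n
    rw [add_sub_cancel, one_pow] at h
    rw [h]
    exact Finset.sum_congr rfl fun k _ => by unfold binPmf; ring
  rw [← hfull]
  symm
  refine Finset.sum_subset (Finset.range_mono h) fun k _ hk => ?_
  have : n < k := by simpa using hk
  simp [binPmf, Nat.choose_eq_zero_of_lt this]

theorem binPmf_zero_succ (n : ℕ) (q : ℝ) : binPmf 0 (n + 1) q = (1 - q) * binPmf 0 n q := by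
  simp [binPmf, pow_succ']

theorem binPmf_succ_succ (k n : ℕ) (q : ℝ) :
    binPmf (k + 1) (n + 1) q = q * binPmf k n q + (1 - q) * binPmf (k + 1) n q := by
  rcases lt_trichotomy n k with h | rfl | h
  · simp [binPmf, Nat.choose_eq_zero_of_lt h, Nat.choose_eq_zero_of_lt (by omega : n + 1 < k + 1),
      Nat.choose_eq_zero_of_lt (by omega : n < k + 1)]
  · simp [binPmf, pow_succ']
  · obtain ⟨d, rfl⟩ := Nat.exists_eq_add_of_lt h
    rw [binPmf, binPmf, binPmf, Nat.choose_succ_succ, show k + d + 1 + 1 - (k + 1) = d + 1 by omega,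
      show k + d + 1 - k = d + 1 by omega, show k + d + 1 - (k + 1) = d by omega]
    push_cast
    ring

/-- The expected shortfall `E (m - N)⁺` of a binomial `N` decreases by `q * P (N < m)` with each
further trial. -/
theorem sum_shortfall_binPmf_sub (m n : ℕ) (q : ℝ) :
    ∑ k ∈ Finset.range m, ((m : ℝ) - k) * binPmf k n q -
        ∑ k ∈ Finset.range m, ((m : ℝ) - k) * binPmf k (n + 1) q =
      q * ∑ k ∈ Finset.range m, binPmf k n q := by
  induction m with
  | zero => simp
  | succ m ih =>
    have hsplit : ∀ f : ℕ → ℝ, ∑ k ∈ Finset.range (m + 1), (((m + 1 : ℕ) : ℝ) - k) * f k =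
        ∑ k ∈ Finset.range m, ((m : ℝ) - k) * f k + ∑ k ∈ Finset.range (m + 1), f k := fun f => by
      rw [Finset.sum_range_succ, Finset.sum_range_succ, ← add_assoc, ← Finset.sum_add_distrib]
      congr 1
      · exact Finset.sum_congr rfl fun k _ => by push_cast; ring
      · push_cast; ring
    have hcdf : ∀ l, ∑ k ∈ Finset.range (l + 1), binPmf k (n + 1) q =
        ∑ k ∈ Finset.range (l + 1), binPmf k n q - q * binPmf l n q := fun l => by
      induction l with
      | zero => simp [binPmf_zero_succ]; ring
      | succ l ihl =>
        rw [Finset.sum_range_succ, ihl, Finset.sum_range_succ _ (l + 1), binPmf_succ_succ]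
        ring
    rw [hsplit, hsplit, hcdf, Finset.sum_range_succ]
    linear_combination ih

/-! ### The discrete scaling distribution -/

section Discrete

variable {p s : ℕ → ℝ}

theorem lintegral_discreteDist (p s : ℕ → ℝ) {f : ℝ → ℝ≥0∞} (hf : Measurable f) :
    ∫⁻ x, f x ∂(discreteDist p s) = ∑' j, ENNReal.ofReal (p j) * f (s j) := by
  simp only [discreteDist, lintegral_sum_measure, lintegral_smul_measure, smul_eq_mul,
    lintegral_dirac' _ hf]

theorem isProbabilityMeasure_discreteDist (hp : ∀ j, 0 ≤ p j) (hp_sum : HasSum p 1) :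
    IsProbabilityMeasure (discreteDist p s) := by
  constructor
  have h := lintegral_discreteDist p s (f := fun _ => 1) measurable_const
  simp only [lintegral_one, mul_one] at h
  rw [h, ← ENNReal.ofReal_tsum_of_nonneg hp hp_sum.summable, hp_sum.tsum_eq, ENNReal.ofReal_one]

theorem ae_pos_discreteDist (hs : ∀ j, 0 < s j) : ∀ᵐ x ∂(discreteDist p s), 0 < x := by
  rw [ae_iff]
  have hset : {x : ℝ | ¬ 0 < x} = Iic 0 := by ext; simp
  rw [hset, ← lintegral_indicator_one measurableSet_Iic,
    lintegral_discreteDist p s (measurable_one.indicator measurableSet_Iic)]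
  simp [hs]

theorem lintegral_ofReal_discreteDist (hp : ∀ j, 0 ≤ p j) (hs : ∀ j, 0 < s j)
    (hps : Summable fun j => p j * s j) :
    ∫⁻ x, ENNReal.ofReal x ∂(discreteDist p s) = ENNReal.ofReal (∑' j, p j * s j) := by
  rw [lintegral_discreteDist p s ENNReal.measurable_ofReal,
    ENNReal.ofReal_tsum_of_nonneg (fun j => mul_nonneg (hp j) (hs j).le) hps]
  exact tsum_congr fun j => (ENNReal.ofReal_mul (hp j)).symm

theorem integrable_discreteDist (hp : ∀ j, 0 ≤ p j) (hs : ∀ j, 0 < s j)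
    (hps : Summable fun j => p j * s j) : Integrable (fun x : ℝ => x) (discreteDist p s) := by
  refine ⟨measurable_id.aestronglyMeasurable, ?_⟩
  rw [hasFiniteIntegral_iff_ofReal ((ae_pos_discreteDist hs).mono fun _ h => h.le),
    lintegral_ofReal_discreteDist hp hs hps]
  exact ENNReal.ofReal_lt_top

theorem mean_discreteDist (hp : ∀ j, 0 ≤ p j) (hs : ∀ j, 0 < s j)
    (hps : Summable fun j => p j * s j) : mean (discreteDist p s) = ∑' j, p j * s j := by
  rw [mean, integral_eq_lintegral_of_nonneg_ae ((ae_pos_discreteDist hs).mono fun _ h => h.le)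
    measurable_id.aestronglyMeasurable, lintegral_ofReal_discreteDist hp hs hps,
    ENNReal.toReal_ofReal (tsum_nonneg fun j => mul_nonneg (hp j) (hs j).le)]

theorem tsum_mul_pos (hp : ∀ j, 0 ≤ p j) (hp_sum : HasSum p 1) (hs : ∀ j, 0 < s j)
    (hps : Summable fun j => p j * s j) : 0 < ∑' j, p j * s j := by
  have hex : ∃ j, p j ≠ 0 := by
    by_contra! h
    have h0 : p = 0 := funext h
    rw [h0] at hp_sum
    exact zero_ne_one (hasSum_zero.unique hp_sum)
  obtain ⟨j, hj⟩ := hex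
  exact hps.tsum_pos (fun j => mul_nonneg (hp j) (hs j).le) j
    (mul_pos ((hp j).lt_of_ne' hj) (hs j))

end Discrete

/-! ### The coefficients of the survival function -/

section Coefficients

variable {p s : ℕ → ℝ}

theorem coefC_nonneg (hp : ∀ j, 0 ≤ p j) (hs0 : 0 < s 0) (hs : StrictMono s) (ξ i : ℕ) :
    0 ≤ coefC p s ξ i := by
  have hpos : ∀ j, 0 < s j := fun j => hs0.trans_le (hs.monotone (Nat.zero_le j))
  exact tsum_nonneg fun j => mul_nonneg (hp j) (Finset.sum_nonneg fun k _ =>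
    binPmf_nonneg k i (div_nonneg hs0.le (hpos j).le)
      ((div_le_one (hpos j)).2 (hs.monotone (Nat.zero_le j))))

theorem coefC_le_one (hp : ∀ j, 0 ≤ p j) (hp_sum : HasSum p 1) (hs0 : 0 < s 0)
    (hs : StrictMono s) (ξ i : ℕ) : coefC p s ξ i ≤ 1 := by
  have hpos : ∀ j, 0 < s j := fun j => hs0.trans_le (hs.monotone (Nat.zero_le j))
  rw [← hp_sum.tsum_eq]
  exact (summable_coefC hp hp_sum.summable hs0 hs ξ i).tsum_le_tsum (fun j =>
    mul_le_of_le_one_right (hp j) (sum_binPmf_le_one _ _ (div_nonneg hs0.le (hpos j).le)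
      ((div_le_one (hpos j)).2 (hs.monotone (Nat.zero_le j))))) hp_sum.summable

theorem coefC_eq_one (hp_sum : HasSum p 1) (s : ℕ → ℝ) {ξ i : ℕ} (h : i < ξ) :
    coefC p s ξ i = 1 := by
  have h1 : ∀ j, binCdf (ξ - 1) i (s 0 / s j) = 1 := fun j =>
    sum_binPmf_eq_one (by omega) _
  simp only [coefC, h1, mul_one, hp_sum.tsum_eq]

theorem coefD_zero (p s : ℕ → ℝ) {ξ : ℕ} (hξ : 1 ≤ ξ) : coefD p s ξ 0 = ∑' j, p j * s j := by
  have hξ' : (ξ : ℝ) ≠ 0 := by positivity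
  refine tsum_congr fun j => ?_
  rw [Finset.sum_eq_single_of_mem 0 (Finset.mem_range.2 hξ) fun k _ hk => by
    rw [binPmf, Nat.choose_eq_zero_of_lt (Nat.pos_of_ne_zero hk)]; simp]
  simp [binPmf, div_self hξ']

theorem coefD_sub_coefD_succ (hp : ∀ j, 0 ≤ p j) (hs0 : 0 < s 0) (hs : StrictMono s)
    (hps : Summable fun j => p j * s j) {ξ : ℕ} (hξ : 1 ≤ ξ) (n : ℕ) :
    coefD p s ξ n - coefD p s ξ (n + 1) = s 0 / ξ * coefC p s ξ n := by
  have hpos : ∀ j, 0 < s j := fun j => hs0.trans_le (hs.monotone (Nat.zero_le j))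
  rw [coefD, coefD, ← (summable_coefD hp hps hs0 hs ξ n).tsum_sub
    (summable_coefD hp hps hs0 hs ξ (n + 1)), coefC, ← tsum_mul_left]
  refine tsum_congr fun j => ?_
  have h := sum_shortfall_binPmf_sub ξ n (s 0 / s j)
  have hdiv : ∀ l, ∑ k ∈ Finset.range ξ, ((ξ : ℝ) - k) / ξ * binPmf k l (s 0 / s j) =
      (∑ k ∈ Finset.range ξ, ((ξ : ℝ) - k) * binPmf k l (s 0 / s j)) / ξ := fun l => by
    rw [Finset.sum_div]
    exact Finset.sum_congr rfl fun k _ => by ring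
  rw [hdiv, hdiv, ← mul_sub, ← sub_div, h, binCdf, Nat.sub_add_cancel hξ]
  have := (hpos j).ne'
  field_simp

theorem coefD_eq (hp : ∀ j, 0 ≤ p j) (hs0 : 0 < s 0) (hs : StrictMono s)
    (hps : Summable fun j => p j * s j) {ξ : ℕ} (hξ : 1 ≤ ξ) (n : ℕ) :
    coefD p s ξ n = ∑' j, p j * s j - s 0 / ξ * ∑ i ∈ Finset.range n, coefC p s ξ i := by
  induction n with
  | zero => rw [coefD_zero p s hξ, Finset.range_zero, Finset.sum_empty, mul_zero, sub_zero]
  | succ n ih =>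
    have h := coefD_sub_coefD_succ hp hs0 hs hps hξ n
    rw [Finset.sum_range_succ, mul_add, ← h, ih]
    ring

theorem one_sub_kappa_of_le {ρ m : ℝ} {ξ n : ℕ} (h : n ≤ ξ) :
    1 - kappa ρ m p s ξ n = (1 - ρ) * (1 + ρ * s 0 / (m * ξ)) ^ n := by
  rcases Nat.eq_zero_or_pos n with rfl | hn
  · rw [kappa_zero, pow_zero, mul_one]
  · rw [kappa_of_le ρ m p s ξ n hn h]
    ring

/-- The three cases in the definition of the coefficients obey one convolution recursion, which
mirrors the renewal equation of the survival function. -/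
theorem one_sub_kappa_succ (hp : ∀ j, 0 ≤ p j) (hp_sum : HasSum p 1) (hs0 : 0 < s 0)
    (hs : StrictMono s) (hps : Summable fun j => p j * s j) {ξ : ℕ} (hξ : 1 ≤ ξ) {ρ m : ℝ}
    (hm : m = ∑' j, p j * s j) (n : ℕ) :
    1 - kappa ρ m p s ξ (n + 1) = (1 - ρ) + ρ * s 0 / (m * ξ) *
      ∑ ij ∈ antidiagonal n, (1 - kappa ρ m p s ξ ij.1) * coefC p s ξ ij.2 := by
  have hpos : ∀ j, 0 < s j := fun j => hs0.trans_le (hs.monotone (Nat.zero_le j))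
  have hm0 : m ≠ 0 := hm ▸ (tsum_mul_pos hp hp_sum hpos hps).ne'
  have hξ0 : (ξ : ℝ) ≠ 0 := by positivity
  rcases Nat.lt_or_ge ξ (n + 1) with h | h
  · rw [kappa_of_lt ρ m p s ξ (n + 1) h, coefD_eq hp hs0 hs hps hξ, ← hm,
      ← Finset.Nat.sum_antidiagonal_swap, Finset.Nat.sum_antidiagonal_eq_sum_range_succ_mk]
    simp only [Prod.swap, Nat.add_sub_cancel, sub_mul, one_mul, Finset.sum_sub_distrib,
      Nat.succ_eq_add_one]
    field_simp
    ring
  · have hterm : ∀ ij ∈ antidiagonal n, (1 - kappa ρ m p s ξ ij.1) * coefC p s ξ ij.2 =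
        (1 - ρ) * (1 + ρ * s 0 / (m * ξ)) ^ ij.1 := fun ij hij => by
      have := mem_antidiagonal.1 hij
      rw [one_sub_kappa_of_le (by omega), coefC_eq_one hp_sum s (by omega), mul_one]
    have hgeom := geom_sum_mul (1 + ρ * s 0 / (m * ξ)) (n + 1)
    rw [one_sub_kappa_of_le h, Finset.sum_congr rfl hterm,
      Finset.Nat.sum_antidiagonal_eq_sum_range_succ_mk, ← Finset.mul_sum]
    linear_combination -(1 - ρ) * hgeom

theorem one_sub_kappa_bounds (hp : ∀ j, 0 ≤ p j) (hp_sum : HasSum p 1) (hs0 : 0 < s 0)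
    (hs : StrictMono s) (hps : Summable fun j => p j * s j) {ξ : ℕ} (hξ : 1 ≤ ξ) {ρ m : ℝ}
    (hm : m = ∑' j, p j * s j) (hρ0 : 0 ≤ ρ) (hρ1 : ρ ≤ 1) (n : ℕ) :
    0 ≤ 1 - kappa ρ m p s ξ n ∧
      1 - kappa ρ m p s ξ n ≤ (1 - ρ) * (1 + ρ * s 0 / (m * ξ)) ^ n := by
  have hpos : ∀ j, 0 < s j := fun j => hs0.trans_le (hs.monotone (Nat.zero_le j))
  have hm0 : 0 < m := hm ▸ tsum_mul_pos hp hp_sum hpos hps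
  have hρ : 0 ≤ 1 - ρ := by linarith
  have hc : 0 ≤ ρ * s 0 / (m * ξ) := by positivity
  have hC := coefC_nonneg hp hs0 hs ξ
  induction n using Nat.strong_induction_on with
  | _ n ih =>
    rcases n with _ | n
    · rw [kappa_zero]
      simpa using hρ
    have hlt : ∀ ij ∈ antidiagonal n, ij.1 < n + 1 := fun ij hij => by
      have := mem_antidiagonal.1 hij
      omega
    rw [one_sub_kappa_succ hp hp_sum hs0 hs hps hξ hm]
    constructor
    · exact add_nonneg hρ (mul_nonneg hc (Finset.sum_nonneg fun ij hij =>
        mul_nonneg (ih _ (hlt ij hij)).1 (hC _)))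
    · have hle : ∑ ij ∈ antidiagonal n, (1 - kappa ρ m p s ξ ij.1) * coefC p s ξ ij.2 ≤
          ∑ ij ∈ antidiagonal n, (1 - ρ) * (1 + ρ * s 0 / (m * ξ)) ^ ij.1 :=
        Finset.sum_le_sum fun ij hij =>
          (mul_le_of_le_one_right (ih _ (hlt ij hij)).1
            (coefC_le_one hp hp_sum hs0 hs ξ _)).trans (ih _ (hlt ij hij)).2
      have hgeom := geom_sum_mul (1 + ρ * s 0 / (m * ξ)) (n + 1)
      refine (add_le_add_right (mul_le_mul_of_nonneg_left hle hc) _).trans_eq ?_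
      rw [Finset.Nat.sum_antidiagonal_eq_sum_range_succ_mk, ← Finset.mul_sum]
      linear_combination (1 - ρ) * hgeom

end Coefficients

/-! ### The series solves the renewal equation -/

/-- The tail of the Erlang scale mixture is a mixture of Poisson weights with coefficients `𝒞_i`. -/
theorem mellinConv_erlang_Ioi {p s : ℕ → ℝ} (hp : ∀ j, 0 ≤ p j) (hp_sum : HasSum p 1)
    (hs0 : 0 < s 0) (hs : StrictMono s) {ξ : ℕ} (hξ : 1 ≤ ξ) {x : ℝ} (hx : 0 ≤ x) :
    mellinConv (discreteDist p s) (erlang ξ) (Ioi x) =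
      ∑' i, ENNReal.ofReal (coefC p s ξ i) * ENNReal.ofReal (poissonWeight i (ξ / s 0 * x)) := by
  have hpos : ∀ j, 0 < s j := fun j => hs0.trans_le (hs.monotone (Nat.zero_le j))
  have hξ0 : (0 : ℝ) < ξ := by positivity
  have : IsProbabilityMeasure (erlang ξ) := isProbabilityMeasure_gammaMeasure hξ0 hξ0
  have hy : 0 ≤ ξ / s 0 * x := by positivity
  have hbin : ∀ j i, 0 ≤ binCdf (ξ - 1) i (s 0 / s j) := fun j i =>
    Finset.sum_nonneg fun k _ => binPmf_nonneg k i (div_nonneg hs0.le (hpos j).le)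
      ((div_le_one (hpos j)).2 (hs.monotone (Nat.zero_le j)))
  have htail : ∀ j, erlang ξ (Ioi (x / s j)) = ∑' i,
      ENNReal.ofReal (binCdf (ξ - 1) i (s 0 / s j) * poissonWeight i (ξ / s 0 * x)) := fun j => by
    have hsum : HasSum (fun i => binCdf (ξ - 1) i (s 0 / s j) * poissonWeight i (ξ / s 0 * x))
        (∑ k ∈ Finset.range (ξ - 1 + 1), poissonWeight k (s 0 / s j * (ξ / s 0 * x))) := by
      simp only [binCdf, Finset.sum_mul]
      exact hasSum_sum fun k _ => hasSum_binPmf_mul_poissonWeight k _ _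
    have hg := gammaMeasure_nat_Ioi (n := ξ - 1) hξ0 (div_nonneg hx (hpos j).le)
    rw [Nat.sub_add_cancel hξ] at hg hsum
    rw [erlang, hg, ← ENNReal.ofReal_tsum_of_nonneg
      (fun i => mul_nonneg (hbin j i) (poissonWeight_nonneg i hy)) hsum.summable, hsum.tsum_eq]
    congr 2
    funext k
    congr 1
    field_simp
  have hmeas : Measurable fun t => erlang ξ (Ioi (x / t)) :=
    (measurable_tail (erlang ξ)).comp (measurable_const.div measurable_id)
  rw [mellinConv_Ioi (ae_pos_discreteDist hpos), lintegral_discreteDist p s hmeas]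
  simp only [htail, ← ENNReal.tsum_mul_left]
  rw [ENNReal.tsum_comm]
  refine tsum_congr fun i => ?_
  rw [coefC, ENNReal.ofReal_tsum_of_nonneg (fun j => mul_nonneg (hp j) (hbin j i))
    (summable_coefC hp hp_sum.summable hs0 hs ξ i), ← ENNReal.tsum_mul_right]
  refine tsum_congr fun j => ?_
  rw [ENNReal.ofReal_mul (hp j), ENNReal.ofReal_mul (hbin j i), mul_assoc]

theorem tsum_tsum_eq_tsum_antidiagonal (F : ℕ × ℕ → ℝ≥0∞) :
    ∑' (n : ℕ) (i : ℕ), F (n, i) = ∑' l, ∑ ij ∈ antidiagonal l, F ij := by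
  rw [← ENNReal.tsum_prod (f := fun n i => F (n, i)),
    ← Finset.HasAntidiagonal.sigmaAntidiagonalEquivProd.tsum_eq, ENNReal.tsum_sigma']
  refine tsum_congr fun l => ?_
  rw [← Finset.tsum_subtype' (antidiagonal l) F]
  rfl

/-- A series in Poisson weights whose coefficients obey a convolution recursion solves the renewal
equation whose kernel is the series of the recursion. -/
theorem poissonSeries_renewal {σ C : ℕ → ℝ} (hσ : ∀ n, 0 ≤ σ n) (hC : ∀ n, 0 ≤ C n)
    {a b lam : ℝ} (ha : 0 < a) (hb : 0 ≤ b) (hlam : 0 ≤ lam) (h0 : σ 0 = b)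
    (hrec : ∀ n, σ (n + 1) = b + lam / a * ∑ ij ∈ antidiagonal n, σ ij.1 * C ij.2)
    {u : ℝ} (hu : 0 ≤ u) :
    ∑' n, ENNReal.ofReal (σ n) * ENNReal.ofReal (poissonWeight n (a * u)) =
      ENNReal.ofReal b + ENNReal.ofReal lam * ∫⁻ x in Ioc 0 u,
        (∑' n, ENNReal.ofReal (σ n) * ENNReal.ofReal (poissonWeight n (a * (u - x)))) *
          ∑' i, ENNReal.ofReal (C i) * ENNReal.ofReal (poissonWeight i (a * x)) := by
  have hw : ∀ n, 0 ≤ poissonWeight n (a * u) := fun n =>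
    poissonWeight_nonneg n (mul_nonneg ha.le hu)
  have hm : ∀ n, Measurable (poissonWeight n) := fun n => (continuous_poissonWeight n).measurable
  have hint : ∫⁻ x in Ioc 0 u,
      (∑' n, ENNReal.ofReal (σ n) * ENNReal.ofReal (poissonWeight n (a * (u - x)))) *
        ∑' i, ENNReal.ofReal (C i) * ENNReal.ofReal (poissonWeight i (a * x)) =
      ∑' l, ∑ ij ∈ antidiagonal l,
        ENNReal.ofReal (σ ij.1 * C ij.2 * (poissonWeight (l + 1) (a * u) / a)) := by
    simp only [← ENNReal.tsum_mul_left, ← ENNReal.tsum_mul_right]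
    have hm1 : ∀ n, Measurable fun x => ENNReal.ofReal (poissonWeight n (a * (u - x))) := fun n =>
      ((hm n).comp (by fun_prop)).ennreal_ofReal
    have hm2 : ∀ n, Measurable fun x => ENNReal.ofReal (poissonWeight n (a * x)) := fun n =>
      ((hm n).comp (by fun_prop)).ennreal_ofReal
    have hm12 : ∀ n i, Measurable fun x =>
        ENNReal.ofReal (σ n) * ENNReal.ofReal (poissonWeight n (a * (u - x))) *
          (ENNReal.ofReal (C i) * ENNReal.ofReal (poissonWeight i (a * x))) := fun n i =>
      ((hm1 n).const_mul _).mul ((hm2 i).const_mul _)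
    rw [lintegral_tsum fun i => (Measurable.tsum fun n => hm12 n i).aemeasurable]
    have hterm : ∀ i, ∫⁻ x in Ioc 0 u, ∑' n,
        ENNReal.ofReal (σ n) * ENNReal.ofReal (poissonWeight n (a * (u - x))) *
          (ENNReal.ofReal (C i) * ENNReal.ofReal (poissonWeight i (a * x))) =
        ∑' n, ENNReal.ofReal (σ n * C i * (poissonWeight (n + i + 1) (a * u) / a)) := fun i => by
      rw [lintegral_tsum fun n => (hm12 n i).aemeasurable]
      refine tsum_congr fun n => ?_
      rw [ENNReal.ofReal_mul (mul_nonneg (hσ n) (hC i)), ENNReal.ofReal_mul (hσ n),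
        ← lintegral_poissonWeight_mul ha hu, ← lintegral_const_mul _ (by exact (hm1 n).mul (hm2 i))]
      exact lintegral_congr fun x => by ring
    simp only [hterm]
    rw [ENNReal.tsum_comm, tsum_tsum_eq_tsum_antidiagonal fun ij =>
      ENNReal.ofReal (σ ij.1 * C ij.2 * (poissonWeight (ij.1 + ij.2 + 1) (a * u) / a))]
    refine tsum_congr fun l => Finset.sum_congr rfl fun ij hij => ?_
    rw [mem_antidiagonal.1 hij]
  have hb' : ENNReal.ofReal b =
      ∑' n, ENNReal.ofReal b * ENNReal.ofReal (poissonWeight n (a * u)) := by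
    rw [ENNReal.tsum_mul_left, ← ENNReal.ofReal_tsum_of_nonneg hw (hasSum_poissonWeight _).summable,
      (hasSum_poissonWeight _).tsum_eq, ENNReal.ofReal_one, mul_one]
  rw [hint, hb', tsum_eq_zero_add' ENNReal.summable,
    tsum_eq_zero_add' (f := fun n => ENNReal.ofReal b * _) ENNReal.summable, h0, add_assoc,
    ← ENNReal.tsum_mul_left, ← ENNReal.tsum_add]
  congr 1
  refine tsum_congr fun l => ?_
  have hnn : ∀ ij ∈ antidiagonal l,
      0 ≤ σ ij.1 * C ij.2 * (poissonWeight (l + 1) (a * u) / a) := fun ij _ =>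
    mul_nonneg (mul_nonneg (hσ _) (hC _)) (div_nonneg (hw _) ha.le)
  rw [← ENNReal.ofReal_sum_of_nonneg hnn, ← ENNReal.ofReal_mul hlam, ← ENNReal.ofReal_mul hb,
    ← ENNReal.ofReal_mul (hσ _), ← ENNReal.ofReal_add (mul_nonneg hb (hw _))
      (mul_nonneg hlam (Finset.sum_nonneg hnn)), hrec, ← Finset.sum_mul]
  congr 1
  field_simp

/-- Two solutions of a defective renewal equation on `[0, U]` are comparable as soon as one of them
is bounded: the excess of `f` over `g` contracts by the defect `ρ` under iteration. -/
theorem renewal_le {f g k : ℝ → ℝ≥0∞} {c lam ρ D : ℝ≥0∞} {U : ℝ} (hg : Measurable g)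
    (hk : Measurable k)
    (hkρ : lam * ∫⁻ x in Ioi 0, k x ≤ ρ) (hρ : ρ < 1)
    (hf_ren : ∀ u ∈ Icc 0 U, f u = c + lam * ∫⁻ x in Ioc 0 u, f (u - x) * k x)
    (hg_ren : ∀ u ∈ Icc 0 U, g u = c + lam * ∫⁻ x in Ioc 0 u, g (u - x) * k x)
    (hD : D ≠ ∞) (hf : ∀ u ∈ Icc 0 U, f u ≤ D) {u : ℝ} (hu : u ∈ Icc 0 U) : f u ≤ g u := by
  have hiter : ∀ n : ℕ, ∀ v ∈ Icc 0 U, f v ≤ g v + ρ ^ n * D := fun n => by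
    induction n with
    | zero => exact fun v hv => by simpa using (hf v hv).trans le_add_self
    | succ n ih =>
      intro v hv
      have hle : ∫⁻ x in Ioc 0 v, f (v - x) * k x ≤
          (∫⁻ x in Ioc 0 v, g (v - x) * k x) + ρ ^ n * D * ∫⁻ x in Ioi 0, k x := by
        calc ∫⁻ x in Ioc 0 v, f (v - x) * k x
            ≤ ∫⁻ x in Ioc 0 v, (g (v - x) * k x + ρ ^ n * D * k x) := by
              refine setLIntegral_mono' measurableSet_Ioc fun x hx => ?_
              rw [← add_mul]
              gcongr
              exact ih (v - x) ⟨by linarith [hx.2], by linarith [hx.1, hv.2]⟩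
          _ = (∫⁻ x in Ioc 0 v, g (v - x) * k x) + ρ ^ n * D * ∫⁻ x in Ioc 0 v, k x := by
              rw [lintegral_add_left (by fun_prop), lintegral_const_mul _ hk]
          _ ≤ _ := by
              gcongr
              exact Ioc_subset_Ioi_self
      calc f v ≤ c + lam * ((∫⁻ x in Ioc 0 v, g (v - x) * k x) +
            ρ ^ n * D * ∫⁻ x in Ioi 0, k x) := by
            rw [hf_ren v hv]; gcongr
        _ = g v + (lam * ∫⁻ x in Ioi 0, k x) * (ρ ^ n * D) := by
            rw [hg_ren v hv]; ring
        _ ≤ g v + ρ * (ρ ^ n * D) := by gcongr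
        _ = g v + ρ ^ (n + 1) * D := by ring
  have hlim : Tendsto (fun n : ℕ => g u + ρ ^ n * D) atTop (𝓝 (g u + 0 * D)) :=
    tendsto_const_nhds.add (ENNReal.Tendsto.mul_const
      (ENNReal.tendsto_pow_atTop_nhds_zero_of_lt_one hρ) (Or.inr hD))
  rw [zero_mul, add_zero] at hlim
  exact ge_of_tendsto' hlim fun n => hiter n u hu

theorem poissonSeries_le {σ : ℕ → ℝ} {a b U v : ℝ} (ha : 0 ≤ a) (hb : 0 ≤ b)
    (hσ : ∀ n, σ n ≤ b ^ n) (hv : v ∈ Icc 0 U) :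
    ∑' n, ENNReal.ofReal (σ n) * ENNReal.ofReal (poissonWeight n (a * v)) ≤
      ENNReal.ofReal (Real.exp (b * (a * U))) := by
  have hU : 0 ≤ U := hv.1.trans hv.2
  have hsum := hasSum_pow_div_factorial (b * (a * U))
  rw [← hsum.tsum_eq, ENNReal.ofReal_tsum_of_nonneg (fun n => by positivity) hsum.summable]
  refine ENNReal.tsum_le_tsum fun n => ?_
  rw [mul_pow, mul_div_assoc, ENNReal.ofReal_mul (by positivity)]
  gcongr
  · exact hσ n
  · have hexp : Real.exp (-(a * v)) ≤ 1 := Real.exp_le_one_iff.2 (by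
      have := mul_nonneg ha hv.1
      linarith)
    have hpow : (a * v) ^ n ≤ (a * U) ^ n :=
      pow_le_pow_left₀ (mul_nonneg ha hv.1) (mul_le_mul_of_nonneg_left hv.2 ha) n
    rw [poissonWeight]
    gcongr
    exact (mul_le_of_le_one_right (pow_nonneg (mul_nonneg ha hv.1) n) hexp).trans hpow

/-- The survival function of the Erlang scale mixture model is a series in Poisson weights. -/
theorem compoundGeometric_Iic_eq_tsum {p s : ℕ → ℝ} (hp : ∀ j, 0 ≤ p j) (hp_sum : HasSum p 1)
    (hs0 : 0 < s 0) (hs : StrictMono s) (hps : Summable fun j => p j * s j) {ξ : ℕ} (hξ : 1 ≤ ξ)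
    {ρ m : ℝ} (hm : m = ∑' j, p j * s j) (hρ0 : 0 ≤ ρ) (hρ1 : ρ < 1)
    {B : Measure ℝ} [IsProbabilityMeasure B]
    (hB : B = mellinConv (discreteDist p s) (erlang ξ)) (hB0 : B (Iio 0) = 0)
    (hBint : Integrable (fun x : ℝ => x) B) (hBm : mean B = m) {u : ℝ} (hu : 0 ≤ u) :
    compoundGeometric ρ (integratedTail B) (Iic u) =
      ∑' n, ENNReal.ofReal (1 - kappa ρ m p s ξ n) *
        ENNReal.ofReal (poissonWeight n (ξ / s 0 * u)) := by
  have hpos : ∀ j, 0 < s j := fun j => hs0.trans_le (hs.monotone (Nat.zero_le j))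
  have hm0 : 0 < m := hm ▸ tsum_mul_pos hp hp_sum hpos hps
  have hBm0 : 0 < mean B := hBm.symm ▸ hm0
  have hξ0 : (0 : ℝ) < ξ := by positivity
  have ha : 0 < ξ / s 0 := div_pos hξ0 hs0
  have hlam : 0 ≤ ρ / m := div_nonneg hρ0 hm0.le
  have hlamB : ρ / m * mean B = ρ := by rw [hBm, div_mul_cancel₀ _ hm0.ne']
  have hbounds := one_sub_kappa_bounds hp hp_sum hs0 hs hps hξ hm hρ0 hρ1.le
  have hH := isProbabilityMeasure_integratedTail hB0 hBint hBm0
  have hMprob : IsProbabilityMeasure (compoundGeometric ρ (integratedTail B)) :=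
    isProbabilityMeasure_compoundGeometric hρ0 hρ1 _
  set M := compoundGeometric ρ (integratedTail B) with hM
  set f : ℝ → ℝ≥0∞ := fun v => ∑' n, ENNReal.ofReal (1 - kappa ρ m p s ξ n) *
    ENNReal.ofReal (poissonWeight n (ξ / s 0 * v)) with hf
  have hMmeas : Measurable fun v => M (Iic v) := measurable_measure_Iic M
  have hfmeas : Measurable f := Measurable.tsum fun n =>
    (((continuous_poissonWeight n).measurable.comp
      (measurable_const_mul _)).ennreal_ofReal).const_mul _
  have hkρ : ENNReal.ofReal (ρ / m) * ∫⁻ x in Ioi 0, B (Ioi x) ≤ ENNReal.ofReal ρ := by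
    rw [lintegral_tail_eq_mean hB0 hBint, ← ENNReal.ofReal_mul hlam, hlamB]
  have hρlt : ENNReal.ofReal ρ < 1 := by
    rw [← ENNReal.ofReal_one]
    exact (ENNReal.ofReal_lt_ofReal_iff one_pos).2 hρ1
  have hM_ren : ∀ v ∈ Icc 0 u, M (Iic v) = ENNReal.ofReal (1 - ρ) +
      ENNReal.ofReal (ρ / m) * ∫⁻ x in Ioc 0 v, M (Iic (v - x)) * B (Ioi x) := fun v hv => by
    have h := survival_renewal hB0 hBint hBm0 hlam hv.1
    rw [hlamB, ← hM] at h
    -- the distribution function vanishes on the negative half-line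
    have hz : ∫⁻ x in Ioi v, M (Iic (v - x)) * B (Ioi x) = 0 := by
      rw [← lintegral_zero (μ := volume.restrict (Ioi v))]
      refine setLIntegral_congr_fun measurableSet_Ioi fun x (hx : v < x) => ?_
      rw [hM, compoundGeometric_Iic_of_neg (integratedTail_Iio_zero B) (by linarith), zero_mul]
    rw [h, ← Ioc_union_Ioi_eq_Ioi hv.1, lintegral_union measurableSet_Ioi
      (Set.disjoint_left.2 fun x hx hx' => not_lt.2 hx.2 hx'), hz, add_zero]
  have hf_ren : ∀ v ∈ Icc 0 u, f v = ENNReal.ofReal (1 - ρ) +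
      ENNReal.ofReal (ρ / m) * ∫⁻ x in Ioc 0 v, f (v - x) * B (Ioi x) := fun v hv => by
    have h := poissonSeries_renewal (σ := fun n => 1 - kappa ρ m p s ξ n) (C := coefC p s ξ)
      (fun n => (hbounds n).1) (coefC_nonneg hp hs0 hs ξ) ha (by linarith : 0 ≤ 1 - ρ) hlam
      (by rw [kappa_zero]) (fun n => by
        rw [one_sub_kappa_succ hp hp_sum hs0 hs hps hξ hm]
        congr 2
        field_simp) hv.1
    simp only [hf]
    rw [h]
    congr 2
    refine setLIntegral_congr_fun measurableSet_Ioc fun x hx => ?_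
    rw [hB, mellinConv_erlang_Ioi hp hp_sum hs0 hs hξ hx.1.le]
  have hσle : ∀ n, 1 - kappa ρ m p s ξ n ≤ (1 + ρ * s 0 / (m * ξ)) ^ n := fun n =>
    (hbounds n).2.trans (mul_le_of_le_one_left (by positivity) (by linarith))
  have hfle : ∀ v ∈ Icc 0 u, f v ≤
      ENNReal.ofReal (Real.exp ((1 + ρ * s 0 / (m * ξ)) * (ξ / s 0 * u))) := fun v hv =>
    poissonSeries_le ha.le (by positivity) hσle hv
  have hu' : u ∈ Icc 0 u := ⟨hu, le_rfl⟩
  exact le_antisymm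
    (renewal_le hfmeas (measurable_tail B) hkρ hρlt hM_ren hf_ren ENNReal.one_ne_top
      (fun _ _ => prob_le_one) hu')
    (renewal_le hMmeas (measurable_tail B) hkρ hρlt hf_ren hM_ren ENNReal.ofReal_ne_top hfle hu')

theorem hasSum_kappa_psi {p s : ℕ → ℝ} (hp : ∀ j, 0 ≤ p j) (hp_sum : HasSum p 1)
    (hs0 : 0 < s 0) (hs : StrictMono s) (hps : Summable fun j => p j * s j) {ξ : ℕ} (hξ : 1 ≤ ξ)
    {ρ m : ℝ} (hm : m = ∑' j, p j * s j) (hρ0 : 0 ≤ ρ) (hρ1 : ρ < 1)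
    {B : Measure ℝ} [IsProbabilityMeasure B]
    (hB : B = mellinConv (discreteDist p s) (erlang ξ)) (hB0 : B (Iio 0) = 0)
    (hBint : Integrable (fun x : ℝ => x) B) (hBm : mean B = m) {u : ℝ} (hu : 0 ≤ u) :
    HasSum (fun n => kappa ρ m p s ξ n * poissonWeight n (ξ / s 0 * u))
      (psi ρ (integratedTail B) u) := by
  have hpos : ∀ j, 0 < s j := fun j => hs0.trans_le (hs.monotone (Nat.zero_le j))
  have hBm0 : 0 < mean B := by rw [hBm, hm]; exact tsum_mul_pos hp hp_sum hpos hps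
  have hH := isProbabilityMeasure_integratedTail hB0 hBint hBm0
  have hMprob : IsProbabilityMeasure (compoundGeometric ρ (integratedTail B)) :=
    isProbabilityMeasure_compoundGeometric hρ0 hρ1 _
  have hσ := fun n => (one_sub_kappa_bounds hp hp_sum hs0 hs hps hξ hm hρ0 hρ1.le n).1
  have hw : ∀ n, 0 ≤ poissonWeight n (ξ / s 0 * u) := fun n =>
    poissonWeight_nonneg n (by positivity)
  have htsum := compoundGeometric_Iic_eq_tsum hp hp_sum hs0 hs hps hξ hm hρ0 hρ1 hB hB0 hBint hBm hu
  simp only [← ENNReal.ofReal_mul (hσ _)] at htsum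
  have hsurv := ENNReal.hasSum_toReal (htsum ▸ measure_ne_top _ _)
  simp only [ENNReal.toReal_ofReal (mul_nonneg (hσ _) (hw _))] at hsurv
  have hsum : ∑' n, (1 - kappa ρ m p s ξ n) * poissonWeight n (ξ / s 0 * u) =
      (compoundGeometric ρ (integratedTail B)).real (Iic u) := by
    rw [measureReal_def, htsum, ENNReal.tsum_toReal_eq fun _ => ENNReal.ofReal_ne_top]
    exact tsum_congr fun n => (ENNReal.toReal_ofReal (mul_nonneg (hσ n) (hw n))).symm
  rw [hsum] at hsurv
  rw [psi_eq_compoundGeometric hρ0 hρ1 _ hu, ← compl_Iic,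
    probReal_compl_eq_one_sub measurableSet_Iic]
  refine ((hasSum_poissonWeight (ξ / s 0 * u)).sub hsurv).congr_fun fun n => ?_
  ring

end Ruin

theorem theorem3p5
    -- the original risk model: Poisson intensity `γ` and claim size distribution `F`
    (γ : ℝ) (hγ : 0 < γ)
    (F : Measure ℝ) [IsProbabilityMeasure F] (hF_nonneg : F (Set.Iio 0) = 0)
    (hF_int : Integrable (fun x : ℝ => x) F) (hF_pos : 0 < Ruin.mean F)
    (hρ : γ * Ruin.mean F < 1)
    -- the scaling distribution: mass `p j` at `s j`, with finite mean
    (p s : ℕ → ℝ) (hp : ∀ j, 0 ≤ p j) (hp_sum : HasSum p 1)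
    (hs_pos : 0 < s 0) (hs : StrictMono s) (hps : Summable fun j => p j * s j)
    (ξ : ℕ) (hξ : 1 ≤ ξ)
    -- the approximating Cramér–Lundberg model
    {Ω : Type*} [MeasurableSpace Ω] (P : Measure Ω) [IsProbabilityMeasure P]
    (T X : ℕ → Ω → ℝ)
    (hCL : Ruin.IsCramerLundberg P
      (γ * Ruin.mean F / Ruin.mean (Ruin.discreteDist p s))
      (Ruin.mellinConv (Ruin.discreteDist p s) (Ruin.erlang ξ)) T X)
    (u : ℝ) (hu : 0 ≤ u) :
    Ruin.ruinProbability P T X u =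
        Ruin.psi (γ * Ruin.mean F)
          (Ruin.mellinConv (Ruin.momentDist (Ruin.discreteDist p s))
            (Ruin.integratedTail (Ruin.erlang ξ))) u ∧
      HasSum
        (fun n : ℕ =>
          Ruin.kappa (γ * Ruin.mean F) (Ruin.mean (Ruin.discreteDist p s)) p s ξ n *
            ((ξ * u / s 0) ^ n * Real.exp (-(ξ * u / s 0)) / (n.factorial : ℝ)))
        (Ruin.psi (γ * Ruin.mean F)
          (Ruin.mellinConv (Ruin.momentDist (Ruin.discreteDist p s))
            (Ruin.integratedTail (Ruin.erlang ξ))) u) := by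
  have hpos : ∀ j, 0 < s j := fun j => hs_pos.trans_le (hs.monotone (Nat.zero_le j))
  have hρ0 : 0 < γ * Ruin.mean F := mul_pos hγ hF_pos
  have hξ0 : (0 : ℝ) < ξ := by positivity
  have hDprob : IsProbabilityMeasure (Ruin.discreteDist p s) :=
    Ruin.isProbabilityMeasure_discreteDist hp hp_sum
  have hDpos := Ruin.ae_pos_discreteDist (p := p) hpos
  have hDint := Ruin.integrable_discreteDist hp hpos hps
  have hDm := Ruin.mean_discreteDist hp hpos hps
  have hDm0 : 0 < Ruin.mean (Ruin.discreteDist p s) :=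
    hDm ▸ Ruin.tsum_mul_pos hp hp_sum hpos hps
  have hGprob : IsProbabilityMeasure (Ruin.erlang ξ) := isProbabilityMeasure_gammaMeasure hξ0 hξ0
  have hGm : Ruin.mean (Ruin.erlang ξ) = 1 := by
    rw [Ruin.erlang, Ruin.mean_gammaMeasure hξ0 hξ0, div_self hξ0.ne']
  have hBprob : IsProbabilityMeasure
      (Ruin.mellinConv (Ruin.discreteDist p s) (Ruin.erlang ξ)) := by
    unfold Ruin.mellinConv; infer_instance
  have hB0 := Ruin.mellinConv_Iio_zero (G := Ruin.erlang ξ) hDpos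
    (Ruin.gammaMeasure_Iio_zero (ξ : ℝ) (ξ : ℝ))
  have hBint := Ruin.integrable_mellinConv (G := Ruin.erlang ξ) hDint
    (Ruin.integrable_gammaMeasure hξ0 hξ0)
  have hBm : Ruin.mean (Ruin.mellinConv (Ruin.discreteDist p s) (Ruin.erlang ξ)) =
      Ruin.mean (Ruin.discreteDist p s) := by
    rw [Ruin.mean_mellinConv, hGm, mul_one]
  rw [Ruin.mellinConv_momentDist_integratedTail hDpos hDm0 (hGm.symm ▸ one_pos)]
  constructor
  · have hlamB : γ * Ruin.mean F / Ruin.mean (Ruin.discreteDist p s) *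
        Ruin.mean (Ruin.mellinConv (Ruin.discreteDist p s) (Ruin.erlang ξ)) =
        γ * Ruin.mean F := by
      rw [hBm, div_mul_cancel₀ _ hDm0.ne']
    have h := hCL.ruinProbability_eq_psi (div_pos hρ0 hDm0) hB0 hBint (hBm.symm ▸ hDm0)
      (hlamB.symm ▸ hρ) hu
    rwa [hlamB] at h
  · have h := Ruin.hasSum_kappa_psi hp hp_sum hs_pos hs hps hξ hDm hρ0.le hρ rfl hB0 hBint hBm hu
    rw [div_mul_eq_mul_div] at h
    exact h
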